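/- Let $K$ be a totally real number field with ring of integers $R$, let $B$ be a quaternion algebra over $K$ that splits at exactly one infinite place, i.e. $B\otimes_{\mathbb Q}\mathbb R\simeq M(2,\mathbb R)\times\mathbb H^{[K:\mathbb Q]-1}$ ($\mathbb H$ being Hamilton's quaternions), and assume $B\not\simeq M(2,\mathbb Q)$. Let $\iota:B\hookrightarrow M(2,\mathbb R)$ be an embedding, $\mathcal O$ an $R$-order of $B$, and $\Gamma(\mathcal O)=\iota(\mathcal O_1^*)\subset SL(2,\mathbb R)$ the image of the group of elements of reduced norm $1$ of $\mathcal O$. Let $\Gamma\subset SL(2,\mathbb R)$ be a subgroup commensurable with $\Gamma(\mathcal O)$ (for instance $\Gamma(\mathcal O)$ itself), acting on the upper half-plane $\mathfrak H$, and let $X=\Gamma\backslash\mathfrak H$ be the associated Shimura curve. Assume that $X$ has genus zero, i.e. is conformally equivalent to the Riemann sphere. Let $\tau_1,\dots,\tau_r\in\mathfrak H$ represent the elliptic points of $X$, each once, and let $e_j$ be the order of $\tau_j$, i.e. the order of its stabilizer in the image of $\Gamma$ in $PSL(2,\mathbb R)$. Let $t$ be a Hauptmodul of $\Gamma$, i.e.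 a generator over $\mathbb C$ of the field of $\Gamma$-invariant meromorphic functions on $\mathfrak H$, and put $a_j=t(\tau_j)\in\mathbb C\cup\{\infty\}$. Let $$D(t,\tau)=-\frac{\{t,\tau\}}{2t'(\tau)^2},\qquad \{t,\tau\}=\frac{t'''(\tau)}{t'(\tau)}-\frac32\left(\frac{t''(\tau)}{t'(\tau)}\right)^2 .$$ Then there are constants $B_j\in\mathbb C$ such that the automorphic derivative of $t$, as a function of $t$, is $$Q(t)=\frac14\sum_{a_j\neq\infty}\frac{1-1/e_j^2}{(t-a_j)^2}+\sum_{a_j\neq\infty}\frac{B_j}{t-a_j};$$ that is, for each $\tau\in\mathfrak H$ that is neither a pole of $t$ nor an elliptic point of $\Gamma$, $t'(\tau)\neq0$ and $D(t,\tau)=Q(t(\tau))$. Moreover, if $a_j\neq\infty$ for all $j$, then $$\sum_{j=1}^r B_j=\sum_{j=1}^r\left(a_jB_j+\tfrac14(1-1/e_j^2)\right)=\sum_{j=1}^r\left(a_j^2B_j+\tfrac12a_j(1-1/e_j^2)\right)=0,$$ and if $a_s=\infty$ for some $s$, then $$\sum_{j\neq s}B_j=0,\qquad \sum_{j\neq s}\left(a_jB_j+\tfrac14(1-1/e_j^2)\right)=\tfrac14(1-1/e_s^2).$$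 -/

import Mathlib

open scoped UpperHalfPlane MatrixGroups TensorProduct NumberField OnePoint

noncomputable section

namespace ShimuraCurve

/-! ### Orders and their norm-one groups -/

/-- An order of a finite-dimensional algebra `B` over a number field `K`: a subring containing the
ring of integers of `K`, finitely generated as a module over it, and spanning `B` over `K`. -/
def IsOrder {K B : Type*} [Field K] [Ring B] [Algebra K B] (O : Subalgebra (𝓞 K) B) : Prop :=
  (Subalgebra.toSubmodule O).FG ∧ Submodule.span K (O : Set B) = ⊤

/-- The image in `SL(2, ℝ)` of the group of units of reduced norm one of the order `O`, under an
embedding `ι` of the quaternion algebra in `M(2, ℝ)`.  The embedding exhibits `ℝ` as a splitting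
field, so that the reduced norm of `x` (viewed in `ℝ`) is `det (ι x)`. -/
def normOneGroup {K B : Type*} [Field K] [Ring B] [Algebra K B]
    (ι : B →+* Matrix (Fin 2) (Fin 2) ℝ) (O : Subalgebra (𝓞 K) B) : Subgroup SL(2, ℝ) :=
  (Units.map (ι.toMonoidHom.comp (O.val : O →* B))).range.comap Matrix.SpecialLinearGroup.toGL

/-! ### Automorphic functions -/

/-- A meromorphic function on the upper half-plane.  It is represented by a function to `ℂ` in
normal form: away from the poles its values are the true ones, at the poles the value is `0`.
(See `sphereValue` for the value in `ℂ ∪ {∞}`.) -/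
def IsMeromorphic (f : ℍ → ℂ) : Prop :=
  MeromorphicNFOn (f ∘ UpperHalfPlane.ofComplex) {z : ℂ | 0 < z.im}

/-- `τ` is a pole of the meromorphic function `f`. -/
def IsPole (f : ℍ → ℂ) (τ : ℍ) : Prop :=
  meromorphicOrderAt (f ∘ UpperHalfPlane.ofComplex) (τ : ℂ) < 0

open Classical in
/-- The value in the Riemann sphere `ℂ ∪ {∞}` of the meromorphic function `f` at `τ`. -/
def sphereValue (f : ℍ → ℂ) (τ : ℍ) : OnePoint ℂ :=
  if IsPole f τ then ∞ else (f τ : OnePoint ℂ)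

/-- An automorphic function on `Γ`: a `Γ`-invariant meromorphic function on the upper half-plane.
(There is no condition at cusps: the groups considered here have none.) -/
def IsAutomorphicFunction (Γ : Subgroup SL(2, ℝ)) (f : ℍ → ℂ) : Prop :=
  IsMeromorphic f ∧ ∀ γ ∈ Γ, ∀ τ : ℍ, f (γ • τ) = f τ

/-- A Hauptmodul of `Γ`: a generator over `ℂ` of the field of automorphic functions on `Γ`.  That
is, an automorphic function `t` such that each automorphic function equals, as a meromorphic
function (off a closed discrete set), a rational function of `t`. -/
def IsHauptmodul (Γ : Subgroup SL(2, ℝ)) (t : ℍ → ℂ) : Prop :=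
  IsAutomorphicFunction Γ t ∧
    ∀ f : ℍ → ℂ, IsAutomorphicFunction Γ f →
      ∃ R : RatFunc ℂ, f =ᶠ[Filter.codiscrete ℍ] fun τ => R.eval (RingHom.id ℂ) (t τ)

/-- The Riemann surface `Γ \ ℍ` has genus zero, i.e. it is conformally equivalent to the Riemann
sphere.  A holomorphic map from `Γ \ ℍ` to the sphere, not constantly `∞`, is the same as an
automorphic function on `Γ`; and a bijective holomorphic map of Riemann surfaces is a conformal
equivalence. -/
def HasGenusZero (Γ : Subgroup SL(2, ℝ)) : Prop :=
  ∃ f : ℍ → ℂ, IsAutomorphicFunction Γ f ∧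
    (∀ τ σ : ℍ, sphereValue f τ = sphereValue f σ → ∃ γ ∈ Γ, γ • τ = σ) ∧
    Function.Surjective (sphereValue f)

/-! ### Elliptic points -/

/-- The order of the group of those transformations of the upper half-plane induced by elements
of `Γ` which fix `τ` (the order of the stabilizer of `τ` in the image of `Γ` in `PSL(2, ℝ)`). -/
def pointOrder (Γ : Subgroup SL(2, ℝ)) (τ : ℍ) : ℕ :=
  Nat.card ((MulAction.stabilizer Γ τ).map (MulAction.toPermHom Γ ℍ))

/-- `τ` is an elliptic point of `Γ`: it is fixed by an element of `Γ` acting nontrivially. -/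
def IsEllipticPoint (Γ : Subgroup SL(2, ℝ)) (τ : ℍ) : Prop :=
  ∃ γ ∈ Γ, γ • τ = τ ∧ ∃ σ : ℍ, γ • σ ≠ σ

/-- `τ 0, …, τ (r - 1)` represent the elliptic points of `Γ \ ℍ`, each exactly once, and
`e j` is the order of `τ j`. -/
structure IsEllipticSystem (Γ : Subgroup SL(2, ℝ)) {r : ℕ} (τ : Fin r → ℍ) (e : Fin r → ℕ) :
    Prop where
  elliptic : ∀ j, IsEllipticPoint Γ (τ j)
  order_eq : ∀ j, pointOrder Γ (τ j) = e j
  inequivalent : ∀ i j, (∃ γ ∈ Γ, γ • τ i = τ j) → i = j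
  complete : ∀ σ : ℍ, IsEllipticPoint Γ σ → ∃ j, ∃ γ ∈ Γ, γ • τ j = σ

/-! ### The automorphic derivative -/

/-- The Schwarzian derivative `{f, z} = f''' / f' - (3 / 2) (f'' / f') ^ 2`. -/
def schwarzian (f : ℂ → ℂ) (z : ℂ) : ℂ :=
  deriv (deriv (deriv f)) z / deriv f z - 3 / 2 * (deriv (deriv f) z / deriv f z) ^ 2

/-- The automorphic derivative `D(f, z) = -{f, z} / (2 f'(z) ^ 2)`. -/
def automorphicDerivative (f : ℂ → ℂ) (z : ℂ) : ℂ :=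
  -schwarzian f z / (2 * deriv f z ^ 2)

/-! ### Bookkeeping for points of the Riemann sphere -/

open Classical in
/-- The indices `j` with `a j ≠ ∞`. -/
def finiteIndices {r : ℕ} (a : Fin r → OnePoint ℂ) : Finset (Fin r) :=
  Finset.univ.filter fun j => a j ≠ ∞

/-- The complex number underlying a point of the Riemann sphere other than `∞`. -/
def toComplex (x : OnePoint ℂ) : ℂ := x.elim 0 id

end ShimuraCurve

end

/-! The Schwarzian satisfies {F ∘ M} = {F}(M) M'^2 + {M} and vanishes on Möbius maps, so D(t, τ) is
Γ-invariant. Since t generates the function field, D = Φ(t) for a rational function Φ, and it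
remains to find the poles of Φ and its behaviour at infinity.

Both are local questions. Near a point, t = c + v^n in a suitable coordinate v, with c = 0 and n < 0
at a pole. Then D (t - c)^2 tends to (1 - 1/n^2)/4
(`IsLocalForm.tendsto_automorphicDerivative_mul_sq`), and |n| is the order of the point, because t
separates orbits (`pointOrder_eq_natAbs`). So Φ has at most a double pole, with the stated leading
coefficient, at each finite a_j. It is regular elsewhere in the plane and tends to 0 at infinity.
Subtracting principal parts leaves an entire function vanishing at infinity, hence 0
(`exists_partialFractions`).

The linear relations come from expanding Φ at infinity. If infinity is an ordinary value, t has a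
simple pole over it and D t^4 stays bounded, which kills the coefficients of 1/t, 1/t^2 and 1/t^3.
If a_s = ∞, then D t^2 tends to (1 - 1/e_s^2)/4, which gives the first two coefficients.

The genus zero hypothesis provides the global input: a map to the sphere whose fibres are the
orbits. Through it a Hauptmodul is shown to separate orbits (`IsHauptmodul.exists_smul_eq`) and to
be surjective (`IsAutomorphicFunction.surjective_sphereValue`). -/

namespace ShimuraCurve

open Filter Topology Bornology

open UpperHalfPlane (ofComplex)

/-! ### Local theory of meromorphic functions -/

/-- A nonvanishing analytic function has local analytic `n`-th roots. -/
theorem exists_analyticAt_zpow_eq {g : ℂ → ℂ} {w : ℂ} (hg : AnalyticAt ℂ g w) (h0 : g w ≠ 0)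
    {n : ℤ} (hn : n ≠ 0) :
    ∃ k : ℂ → ℂ, AnalyticAt ℂ k w ∧ k w ≠ 0 ∧ ∀ᶠ z in 𝓝 w, k z ^ n = g z := by
  have hn' : (n : ℂ) ≠ 0 := by exact_mod_cast hn
  -- Dividing by `g w` moves the argument of the logarithm near 1, away from the branch cut.
  refine ⟨fun z => Complex.exp ((Complex.log (g z / g w) + Complex.log (g w)) / n), ?_,
    Complex.exp_ne_zero _, ?_⟩
  · have h : AnalyticAt ℂ (fun z => Complex.log (g z / g w)) w :=
      (hg.div_const).clog (by simp [div_self h0])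
    fun_prop
  · filter_upwards [hg.continuousAt.eventually_ne h0] with z hz
    rw [← Complex.exp_int_mul, mul_div_cancel₀ _ hn', Complex.exp_add,
      Complex.exp_log (div_ne_zero hz h0), Complex.exp_log h0, div_mul_cancel₀ _ h0]

/-- Near `w`, the function `F` is `c + v ^ n` for a local coordinate `v` at `w`. -/
structure IsLocalForm (F : ℂ → ℂ) (w c : ℂ) (n : ℤ) (v : ℂ → ℂ) : Prop where
  ne_zero : n ≠ 0
  const_eq_zero : n < 0 → c = 0
  analyticAt : AnalyticAt ℂ v w
  map_zero : v w = 0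
  deriv_ne_zero : deriv v w ≠ 0
  eventually_eq : ∀ᶠ z in 𝓝[≠] w, F z = c + v z ^ n

theorem exists_localCoordinate {g : ℂ → ℂ} {w : ℂ} (hg : AnalyticAt ℂ g w) (h0 : g w ≠ 0)
    {n : ℤ} (hn : n ≠ 0) :
    ∃ v : ℂ → ℂ, AnalyticAt ℂ v w ∧ v w = 0 ∧ deriv v w ≠ 0 ∧
      ∀ᶠ z in 𝓝 w, v z ^ n = (z - w) ^ n * g z := by
  obtain ⟨k, hk, hk0, hkn⟩ := exists_analyticAt_zpow_eq hg h0 hn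
  refine ⟨fun z => (z - w) * k z, by fun_prop, by simp, ?_, ?_⟩
  · have : HasDerivAt (fun z => (z - w) * k z) (1 * k w + (w - w) * deriv k w) w :=
      ((hasDerivAt_id w).sub_const w).mul hk.differentiableAt.hasDerivAt
    rw [this.deriv]
    simpa using hk0
  · filter_upwards [hkn] with z hz
    rw [mul_zpow, hz]

/-- `F` at a pole, and `F - F w` elsewhere, is (z - w)^n times a nonvanishing factor, whose n-th
root is absorbed into the coordinate. Normal form guarantees that `F w` is the true value off the
poles. -/
theorem exists_isLocalForm {F : ℂ → ℂ} {w : ℂ} (hF : MeromorphicNFAt F w)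
    (hnc : ¬ ∃ c, ∀ᶠ z in 𝓝[≠] w, F z = c) :
    ∃ c n v, IsLocalForm F w c n v ∧ (0 < n → F w = c) ∧ (n < 0 ↔ meromorphicOrderAt F w < 0) := by
  by_cases ho : meromorphicOrderAt F w < 0
  · obtain ⟨n, hn⟩ : ∃ n : ℤ, meromorphicOrderAt F w = n :=
      (WithTop.ne_top_iff_exists.1 (ne_top_of_lt ho)).imp fun _ h => h.symm
    have hn0 : n < 0 := by rw [hn] at ho; exact_mod_cast ho
    obtain ⟨g, hg, hg0, hgF⟩ := (meromorphicOrderAt_eq_int_iff hF.meromorphicAt).1 hn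
    obtain ⟨v, hv, hv0, hv1, hvn⟩ := exists_localCoordinate hg hg0 hn0.ne
    refine ⟨0, n, v, ⟨hn0.ne, fun _ => rfl, hv, hv0, hv1, ?_⟩, fun h => absurd hn0 h.not_gt,
      by simp [hn0, ho]⟩
    filter_upwards [hgF, hvn.filter_mono nhdsWithin_le_nhds] with z h1 h2
    rw [h1, h2, zero_add, smul_eq_mul]
  · have hFa := hF.meromorphicOrderAt_nonneg_iff_analyticAt.1 (not_lt.1 ho)
    have hG : AnalyticAt ℂ (fun z => F z - F w) w := by fun_prop
    have htop : analyticOrderAt (fun z => F z - F w) w ≠ ⊤ := by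
      intro h
      rw [analyticOrderAt_eq_top] at h
      exact hnc ⟨F w, (h.mono fun z hz => sub_eq_zero.1 hz).filter_mono nhdsWithin_le_nhds⟩
    obtain ⟨g, hg, hg0, hgF⟩ := hG.analyticOrderAt_ne_top.1 htop
    set m := analyticOrderNatAt (fun z => F z - F w) w
    have hm : m ≠ 0 := by
      intro hm
      have := hgF.self_of_nhds
      simp [hm] at this
      exact hg0 this.symm
    have hn0 : (0 : ℤ) < m := by positivity
    obtain ⟨v, hv, hv0, hv1, hvn⟩ := exists_localCoordinate hg hg0 hn0.ne'
    refine ⟨F w, m, v, ⟨hn0.ne', fun h => absurd hn0 h.not_gt, hv, hv0, hv1, ?_⟩, fun _ => rfl,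
      by simp [hn0.not_gt, ho]⟩
    filter_upwards [hgF.filter_mono nhdsWithin_le_nhds,
      hvn.filter_mono nhdsWithin_le_nhds] with z h1 h2
    rw [h2, zpow_natCast, ← smul_eq_mul, ← h1]
    ring

namespace IsLocalForm

variable {F : ℂ → ℂ} {w c : ℂ} {n : ℤ} {v : ℂ → ℂ}

theorem tendsto_coordinate (h : IsLocalForm F w c n v) : Tendsto v (𝓝[≠] w) (𝓝[≠] 0) := by
  have := h.analyticAt.differentiableAt.hasDerivAt.tendsto_nhdsNE h.deriv_ne_zero
  rwa [h.map_zero] at this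

theorem map_nhds_coordinate (h : IsLocalForm F w c n v) : map v (𝓝 w) = 𝓝 0 := by
  have := h.analyticAt.hasStrictDerivAt.map_nhds_eq h.deriv_ne_zero
  rwa [h.map_zero] at this

theorem eventually_coordinate_ne (h : IsLocalForm F w c n v) : ∀ᶠ z in 𝓝[≠] w, v z ≠ 0 :=
  h.tendsto_coordinate.eventually self_mem_nhdsWithin

theorem exists_injOn (h : IsLocalForm F w c n v) : ∃ s ∈ 𝓝 w, Set.InjOn v s :=
  have hs := h.analyticAt.hasStrictDerivAt.hasStrictFDerivAt_equiv h.deriv_ne_zero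
  ⟨_, (hs.toOpenPartialHomeomorph v).open_source.mem_nhds
    hs.mem_toOpenPartialHomeomorph_source, (hs.toOpenPartialHomeomorph v).injOn⟩

theorem tendsto_of_pos (h : IsLocalForm F w c n v) (hn : 0 < n) :
    Tendsto F (𝓝[≠] w) (𝓝[≠] c) := by
  lift n to ℕ using hn.le
  have hn' : n ≠ 0 := by simpa using hn.ne'
  refine tendsto_nhdsWithin_iff.2 ⟨?_, ?_⟩
  · have : Tendsto (fun z => c + v z ^ n) (𝓝[≠] w) (𝓝 (c + 0 ^ n)) :=
      ((tendsto_nhds_of_tendsto_nhdsWithin h.tendsto_coordinate).pow n).const_add c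
    rw [zero_pow hn', add_zero] at this
    exact this.congr' (h.eventually_eq.mono fun z hz => by rw [hz, zpow_natCast])
  · filter_upwards [h.eventually_eq, h.eventually_coordinate_ne] with z hz hz'
    simp [hz, hz']

theorem tendsto_of_neg (h : IsLocalForm F w c n v) (hn : n < 0) :
    Tendsto F (𝓝[≠] w) (cobounded ℂ) := by
  have h1 := (tendsto_zpow_nhdsNE_zero_cobounded (α := ℂ) hn).comp h.tendsto_coordinate
  refine h1.congr' (h.eventually_eq.mono fun z hz => ?_)
  rw [hz, h.const_eq_zero hn, zero_add]; rfl

end IsLocalForm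

/-! ### The Schwarzian derivative in a local coordinate -/

/-- This is the composition rule for x ↦ c + x^n, whose own Schwarzian is (1 - n^2)/(2x^2); negative
n is allowed so that poles are covered too. -/
theorem schwarzian_const_add_zpow {v : ℂ → ℂ} {z : ℂ} (c : ℂ) {n : ℤ} (hn : n ≠ 0)
    (hv : AnalyticAt ℂ v z) (h0 : v z ≠ 0) (h1 : deriv v z ≠ 0) :
    deriv (fun x => c + v x ^ n) z = n * v z ^ (n - 1) * deriv v z ∧
    schwarzian (fun x => c + v x ^ n) z =
      schwarzian v z + (1 - (n : ℂ) ^ 2) / 2 * (deriv v z / v z) ^ 2 := by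
  have hn' : (n : ℂ) ≠ 0 := by exact_mod_cast hn
  have hev : ∀ᶠ x in 𝓝 z, AnalyticAt ℂ v x ∧ v x ≠ 0 :=
    hv.eventually_analyticAt.and (hv.continuousAt.eventually_ne h0)
  have hpow : ∀ (m : ℤ) x, AnalyticAt ℂ v x ∧ v x ≠ 0 →
      HasDerivAt (fun y => v y ^ m) (m * v x ^ (m - 1) * deriv v x) x := fun m x hx =>
    (hasDerivAt_zpow m (v x) (Or.inl hx.2)).comp x hx.1.differentiableAt.hasDerivAt
  have hd1 : deriv (fun x => c + v x ^ n) =ᶠ[𝓝 z] fun x => n * v x ^ (n - 1) * deriv v x := by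
    filter_upwards [hev] with x hx
    exact ((hpow n x hx).const_add c).deriv
  have hd2 : deriv (deriv fun x => c + v x ^ n) =ᶠ[𝓝 z] fun x =>
      n * (((n - 1 : ℤ) * v x ^ (n - 1 - 1) * deriv v x)) * deriv v x +
        n * v x ^ (n - 1) * deriv (deriv v) x := by
    refine hd1.deriv.trans ?_
    filter_upwards [hev] with x hx
    exact (((hpow (n - 1) x hx).const_mul (n : ℂ)).mul
      hx.1.deriv.differentiableAt.hasDerivAt).deriv
  have hd3 : deriv (deriv (deriv fun x => c + v x ^ n)) z =
      (n * ((n - 1 : ℤ) * ((n - 1 - 1 : ℤ) * v z ^ (n - 1 - 1 - 1) * deriv v z) * deriv v z +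
        (n - 1 : ℤ) * v z ^ (n - 1 - 1) * deriv (deriv v) z)) * deriv v z +
      n * (((n - 1 : ℤ) * v z ^ (n - 1 - 1) * deriv v z)) * deriv (deriv v) z +
      (n * ((n - 1 : ℤ) * v z ^ (n - 1) / v z * deriv v z) * deriv (deriv v) z +
        n * v z ^ (n - 1) * deriv (deriv (deriv v)) z) := by
    rw [hd2.deriv_eq]
    have hx := hev.self_of_nhds
    have e1 := hx.1.deriv.differentiableAt.hasDerivAt
    have e2 := hx.1.deriv.deriv.differentiableAt.hasDerivAt
    have := ((((((hpow (n - 1 - 1) z hx).const_mul ((n - 1 : ℤ) : ℂ)).mul e1).const_mul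
      (n : ℂ)).mul e1).add (((hpow (n - 1) z hx).const_mul (n : ℂ)).mul e2)).deriv
    refine Eq.trans this ?_
    simp only [Pi.mul_apply, zpow_sub_one₀ h0]
    field_simp
  refine ⟨hd1.self_of_nhds, ?_⟩
  rw [schwarzian, schwarzian, hd3, hd2.self_of_nhds, hd1.self_of_nhds]
  simp only [zpow_sub_one₀ h0]
  have hp : v z ^ n ≠ 0 := zpow_ne_zero n h0
  push_cast
  field_simp
  ring

/-! ### The automorphic derivative near a point -/

theorem schwarzian_congr {f g : ℂ → ℂ} {z : ℂ} (h : f =ᶠ[𝓝 z] g) :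
    schwarzian f z = schwarzian g z := by
  rw [schwarzian, schwarzian, h.deriv.deriv.deriv_eq, h.deriv.deriv_eq, h.deriv_eq]

theorem automorphicDerivative_congr {f g : ℂ → ℂ} {z : ℂ} (h : f =ᶠ[𝓝 z] g) :
    automorphicDerivative f z = automorphicDerivative g z := by
  rw [automorphicDerivative, automorphicDerivative, schwarzian_congr h, h.deriv_eq]

theorem meromorphicAt_automorphicDerivative {f : ℂ → ℂ} {z : ℂ} (hf : MeromorphicAt f z) :
    MeromorphicAt (automorphicDerivative f) z := by
  have h1 := hf.deriv
  have h2 := h1.deriv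
  have h3 := h2.deriv
  unfold automorphicDerivative schwarzian
  fun_prop

theorem analyticAt_schwarzian {f : ℂ → ℂ} {z : ℂ} (hf : AnalyticAt ℂ f z) (h0 : deriv f z ≠ 0) :
    AnalyticAt ℂ (schwarzian f) z := by
  have h1 := hf.deriv
  have h2 := h1.deriv
  have h3 := h2.deriv
  unfold schwarzian
  exact (h3.div h1 h0).sub (analyticAt_const.mul ((h2.div h1 h0).pow 2))

theorem analyticAt_automorphicDerivative {f : ℂ → ℂ} {z : ℂ} (hf : AnalyticAt ℂ f z)
    (h0 : deriv f z ≠ 0) : AnalyticAt ℂ (automorphicDerivative f) z := by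
  unfold automorphicDerivative
  exact (analyticAt_schwarzian hf h0).neg.div (analyticAt_const.mul (hf.deriv.pow 2)) (by simpa)

namespace IsLocalForm

variable {F : ℂ → ℂ} {w c : ℂ} {n : ℤ} {v : ℂ → ℂ}

/-- Dividing the Schwarzian of c + v^n by F'^2 = (n v^n v'/v)^2 separates a constant depending only
on n from a correction of order v^2. -/
theorem eventually_automorphicDerivative (h : IsLocalForm F w c n v) :
    ∀ᶠ z in 𝓝[≠] w, v z ≠ 0 ∧ F z = c + v z ^ n ∧ automorphicDerivative F z * (v z ^ n) ^ 2 =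
      1 / 4 * (1 - 1 / (n : ℂ) ^ 2) -
        schwarzian v z / (2 * n ^ 2 * deriv v z ^ 2) * v z ^ 2 := by
  have hn : (n : ℂ) ≠ 0 := by exact_mod_cast h.ne_zero
  filter_upwards [eventually_eventually_nhdsWithin.2 h.eventually_eq, h.eventually_eq,
    h.eventually_coordinate_ne, self_mem_nhdsWithin,
    h.analyticAt.eventually_analyticAt.filter_mono nhdsWithin_le_nhds,
    (h.analyticAt.deriv.continuousAt.eventually_ne h.deriv_ne_zero).filter_mono
      nhdsWithin_le_nhds] with z hz hz' h0 hzw hv h1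
  -- At z ≠ w the punctured condition is a full neighbourhood condition, so the two sides may be
  -- differentiated.
  rw [isOpen_compl_singleton.nhdsWithin_eq hzw] at hz
  obtain ⟨e1, e2⟩ := schwarzian_const_add_zpow c h.ne_zero hv h0 h1
  refine ⟨h0, hz', ?_⟩
  rw [automorphicDerivative_congr hz, automorphicDerivative, e1, e2, zpow_sub_one₀ h0]
  have hp : v z ^ n ≠ 0 := zpow_ne_zero n h0
  field_simp
  ring

/-- The limit of `{v, z} / v' ^ 2` at the centre of the coordinate `v`. -/
theorem tendsto_schwarzian_div (h : IsLocalForm F w c n v) :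
    ∃ L, Tendsto (fun z => schwarzian v z / (2 * n ^ 2 * deriv v z ^ 2)) (𝓝[≠] w) (𝓝 L) := by
  have hn : (n : ℂ) ≠ 0 := by exact_mod_cast h.ne_zero
  have : AnalyticAt ℂ (fun z => schwarzian v z / (2 * n ^ 2 * deriv v z ^ 2)) w :=
    (analyticAt_schwarzian h.analyticAt h.deriv_ne_zero).div
      (analyticAt_const.mul (h.analyticAt.deriv.pow 2)) (by simp [hn, h.deriv_ne_zero])
  exact ⟨_, this.continuousAt.tendsto.mono_left nhdsWithin_le_nhds⟩

theorem tendsto_automorphicDerivative_mul_sq (h : IsLocalForm F w c n v) :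
    Tendsto (fun z => automorphicDerivative F z * (F z - c) ^ 2) (𝓝[≠] w)
      (𝓝 (1 / 4 * (1 - 1 / (n : ℂ) ^ 2))) := by
  obtain ⟨L, hL⟩ := h.tendsto_schwarzian_div
  have hv := tendsto_nhds_of_tendsto_nhdsWithin h.tendsto_coordinate
  have := (tendsto_const_nhds (x := 1 / 4 * (1 - 1 / (n : ℂ) ^ 2))).sub (hL.mul (hv.pow 2))
  simp only [ne_eq, OfNat.ofNat_ne_zero, not_false_eq_true, zero_pow, mul_zero, sub_zero] at this
  refine this.congr' ?_
  filter_upwards [h.eventually_automorphicDerivative] with z ⟨_, h2, h3⟩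
  rw [h2, add_sub_cancel_left, h3]

/-- For n = -1 the constant 1 - 1/n^2 vanishes and F = 1/v, so the v^2 in the correction cancels the
two extra powers of F. -/
theorem tendsto_automorphicDerivative_mul_pow_four (h : IsLocalForm F w c n v) (hn : n = -1) :
    ∃ L, Tendsto (fun z => automorphicDerivative F z * F z ^ 4) (𝓝[≠] w) (𝓝 L) := by
  obtain ⟨L, hL⟩ := h.tendsto_schwarzian_div
  refine ⟨-L, hL.neg.congr' ?_⟩
  filter_upwards [h.eventually_automorphicDerivative] with z ⟨h1, h2, h3⟩
  subst hn
  rw [h.const_eq_zero (by norm_num), zero_add] at h2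
  have : automorphicDerivative F z * F z ^ 4 =
      (automorphicDerivative F z * (v z ^ (-1 : ℤ)) ^ 2) * (v z ^ (-1 : ℤ)) ^ 2 := by rw [h2]; ring
  rw [this, h3, zpow_neg_one]
  field_simp
  simp

end IsLocalForm

/-! ### Limits in the Riemann sphere -/

/-- Existence of a limit in the sphere, known beforehand, lets the limit be computed along the
values of t alone, via `tendsto_of_comp`. -/
theorem MeromorphicAt.exists_tendsto_onePoint {Φ : ℂ → ℂ} {c : ℂ} (h : MeromorphicAt Φ c) :
    ∃ L : OnePoint ℂ, Tendsto (fun x => (Φ x : OnePoint ℂ)) (𝓝[≠] c) (𝓝 L) := by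
  by_cases ho : meromorphicOrderAt Φ c < 0
  · refine ⟨∞, OnePoint.tendsto_coe_infty.comp ?_⟩
    rw [coclosedCompact_eq_cocompact, ← Metric.cobounded_eq_cocompact]
    exact tendsto_cobounded_of_meromorphicOrderAt_neg ho
  · obtain ⟨a, ha⟩ := tendsto_nhds_of_meromorphicOrderAt_nonneg h (not_lt.1 ho)
    exact ⟨a, (OnePoint.continuous_coe.tendsto a).comp ha⟩

/-- If `Φ` has a limit in the sphere along `l`, then the limit can be computed along any map. -/
theorem tendsto_of_comp {α : Type*} {Φ : ℂ → ℂ} {l : Filter ℂ} {k : Filter α} [k.NeBot]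
    {T : α → ℂ} {a : ℂ}
    (hΦ : ∃ L : OnePoint ℂ, Tendsto (fun x => (Φ x : OnePoint ℂ)) l (𝓝 L))
    (hT : Tendsto T k l) (h : Tendsto (fun z => Φ (T z)) k (𝓝 a)) : Tendsto Φ l (𝓝 a) := by
  obtain ⟨L, hL⟩ := hΦ
  obtain rfl : L = a := tendsto_nhds_unique (hL.comp hT) ((OnePoint.continuous_coe.tendsto a).comp h)
  exact OnePoint.isOpenEmbedding_coe.tendsto_nhds_iff.2 hL

theorem RatFunc.meromorphicAt_eval (R : RatFunc ℂ) {u : ℂ → ℂ} {c : ℂ} (hu : MeromorphicAt u c) :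
    MeromorphicAt (fun x => R.eval (RingHom.id ℂ) (u x)) c := by
  have key : ∀ p : Polynomial ℂ, MeromorphicAt (fun x => p.eval (u x)) c := fun p => by
    induction p using Polynomial.induction_on' with
    | add p q hp hq => simpa only [Polynomial.eval_add] using! hp.add hq
    | monomial n a =>
      simpa only [Polynomial.eval_monomial] using! (MeromorphicAt.const a c).mul (hu.pow n)
  simp only [RatFunc.eval, Polynomial.eval₂_id]
  exact (key _).div (key _)

theorem exists_tendsto_cobounded_of_meromorphicAt {Φ : ℂ → ℂ}
    (h : MeromorphicAt (fun x => Φ x⁻¹) 0) :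
    ∃ L : OnePoint ℂ, Tendsto (fun x => (Φ x : OnePoint ℂ)) (cobounded ℂ) (𝓝 L) := by
  obtain ⟨L, hL⟩ := MeromorphicAt.exists_tendsto_onePoint h
  refine ⟨L, ?_⟩
  have := hL.comp (tendsto_inv₀_cobounded' (α := ℂ))
  simpa [Function.comp_def] using this

/-! ### Meromorphic functions on the sphere -/

/-- A meromorphic function on the plane which is locally bounded and vanishes at infinity is zero. -/
theorem eventually_eq_zero_of_tendsto {Φ : ℂ → ℂ} (hΦ : MeromorphicOn Φ Set.univ)
    (hlim : ∀ x, ∃ L, Tendsto Φ (𝓝[≠] x) (𝓝 L)) (h0 : Tendsto Φ (cobounded ℂ) (𝓝 0)) (x : ℂ) :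
    ∀ᶠ y in 𝓝[≠] x, Φ y = 0 := by
  set G := toMeromorphicNFOn Φ Set.univ with hG
  have hGΦ : ∀ x, G =ᶠ[𝓝[≠] x] Φ := fun x => hΦ.toMeromorphicNFOn_eq_self_on_nhdsNE (Set.mem_univ x)
  have hGa : ∀ x, AnalyticAt ℂ G x := fun x => by
    rw [← (meromorphicNFOn_toMeromorphicNFOn Φ Set.univ
      (Set.mem_univ x)).meromorphicOrderAt_nonneg_iff_analyticAt]
    rw [← hG, meromorphicOrderAt_congr (hGΦ x)]
    exact (tendsto_nhds_iff_meromorphicOrderAt_nonneg (hΦ x (Set.mem_univ x))).1 (hlim x)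
  have hGd : Differentiable ℂ G := fun x => (hGa x).differentiableAt
  have hG0 : Tendsto G (cocompact ℂ) (𝓝 0) := by
    rw [← Metric.cobounded_eq_cocompact, Metric.tendsto_nhds]
    intro ε hε
    obtain ⟨M, hM⟩ : ∃ M : ℝ, ∀ y : ℂ, M < ‖y‖ → ‖Φ y‖ ≤ ε / 2 := by
      have := h0.eventually (Metric.closedBall_mem_nhds 0 (half_pos hε))
      rw [← comap_norm_atTop] at this
      obtain ⟨M, hM⟩ := (eventually_atTop.1 (eventually_comap.1 this))
      exact ⟨M, fun y hy => by simpa using hM _ hy.le y rfl⟩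
    have : ∀ᶠ y : ℂ in cobounded ℂ, M < ‖y‖ := tendsto_norm_cobounded_atTop.eventually_gt_atTop M
    filter_upwards [this] with y hy
    rw [dist_zero_right]
    refine lt_of_le_of_lt ?_ (half_lt_self hε)
    -- `G` and `Φ` may differ at y itself, so the bound is carried over by continuity of `G` from
    -- nearby points.
    have hGy : Tendsto (fun z => ‖G z‖) (𝓝[≠] y) (𝓝 ‖G y‖) :=
      (hGa y).continuousAt.norm.tendsto.mono_left nhdsWithin_le_nhds
    refine le_of_tendsto hGy ?_
    have hop : ∀ᶠ z in 𝓝 y, M < ‖z‖ := continuous_norm.continuousAt.eventually (lt_mem_nhds hy)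
    filter_upwards [hGΦ y, hop.filter_mono nhdsWithin_le_nhds] with z hz hz'
    rw [hz]
    exact hM z hz'
  filter_upwards [hGΦ x] with y hy
  rw [← hy]
  exact hGd.apply_eq_of_tendsto_cocompact y hG0

/-- The principal part at a pole of order at most two. -/
theorem exists_residue {Φ : ℂ → ℂ} {x m : ℂ} (hΦ : MeromorphicAt Φ x)
    (h : Tendsto (fun y => Φ y * (y - x) ^ 2) (𝓝[≠] x) (𝓝 m)) :
    ∃ β L, Tendsto (fun y => Φ y - m / (y - x) ^ 2 - β / (y - x)) (𝓝[≠] x) (𝓝 L) := by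
  set Ψ := fun y => Φ y * (y - x) ^ 2
  have hΨ : MeromorphicAt Ψ x := by fun_prop
  set g := toMeromorphicNFAt Ψ x with hg
  have hgΨ : Ψ =ᶠ[𝓝[≠] x] g := hΨ.eq_nhdsNE_toMeromorphicNFAt
  have hga : AnalyticAt ℂ g x := by
    rw [hg, ← hΨ.meromorphicOrderAt_nonneg_iff_analyticAt_toMeromorphicNFAt]
    exact (tendsto_nhds_iff_meromorphicOrderAt_nonneg hΨ).1 ⟨m, h⟩
  have hgm : g x = m := tendsto_nhds_unique
    (hga.continuousAt.tendsto.mono_left nhdsWithin_le_nhds) (h.congr' hgΨ)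
  have hs : ∀ f : ℂ → ℂ, AnalyticAt ℂ f x → AnalyticAt ℂ (dslope f x) x := fun f hf => by
    obtain ⟨p, hp⟩ := hf
    exact hp.has_fpower_series_dslope_fslope.analyticAt
  have h2 := hs _ (hs _ hga)
  -- Second-order Taylor expansion: g(y) = m + g'(x)(y - x) + h(y)(y - x)^2, with residue g'(x) and
  -- h the iterated slope.
  refine ⟨dslope g x x, _, (h2.continuousAt.tendsto.mono_left nhdsWithin_le_nhds).congr' ?_⟩
  filter_upwards [hgΨ, self_mem_nhdsWithin] with y hy hyx
  have hyx' : y - x ≠ 0 := sub_ne_zero.2 hyx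
  have e1 := sub_smul_dslope g x y
  have e2 := sub_smul_dslope (dslope g x) x y
  rw [smul_eq_mul] at e1 e2
  rw [hgm, ← hy] at e1
  refine mul_right_cancel₀ (pow_ne_zero 2 hyx') ?_
  have : (Φ y - m / (y - x) ^ 2 - dslope g x x / (y - x)) * (y - x) ^ 2 =
      Φ y * (y - x) ^ 2 - m - dslope g x x * (y - x) := by field_simp
  rw [this]
  linear_combination (y - x) * e2 + e1

/-- Partial fractions for a meromorphic function on the sphere with poles of order at most two. -/
theorem exists_partialFractions {ι : Type*} {Φ : ℂ → ℂ} (hΦ : MeromorphicOn Φ Set.univ)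
    (J : Finset ι) {a m : ι → ℂ} (ha : Set.InjOn a J)
    (hreg : ∀ x, (∀ j ∈ J, a j ≠ x) → ∃ L, Tendsto Φ (𝓝[≠] x) (𝓝 L))
    (hpole : ∀ j ∈ J, Tendsto (fun y => Φ y * (y - a j) ^ 2) (𝓝[≠] (a j)) (𝓝 (m j)))
    (hinf : Tendsto Φ (cobounded ℂ) (𝓝 0)) :
    ∃ β : ι → ℂ, ∀ x, ∀ᶠ y in 𝓝[≠] x,
      Φ y = ∑ j ∈ J, m j / (y - a j) ^ 2 + ∑ j ∈ J, β j / (y - a j) := by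
  classical
  have hres : ∀ j, ∃ β, j ∈ J →
      ∃ L, Tendsto (fun y => Φ y - m j / (y - a j) ^ 2 - β / (y - a j)) (𝓝[≠] (a j)) (𝓝 L) := by
    intro j
    by_cases hj : j ∈ J
    · obtain ⟨β, hβ⟩ := exists_residue (hΦ (a j) trivial) (hpole j hj)
      exact ⟨β, fun _ => hβ⟩
    · exact ⟨0, fun h => absurd h hj⟩
  choose β hβ using hres
  refine ⟨β, fun x => ?_⟩
  set q : ι → ℂ → ℂ := fun j y => m j / (y - a j) ^ 2 + β j / (y - a j) with hq
  have hqc : ∀ j x, a j ≠ x → Tendsto (q j) (𝓝[≠] x) (𝓝 (q j x)) := fun j x hx => by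
    have hx' : x - a j ≠ 0 := sub_ne_zero.2 hx.symm
    have : ContinuousAt (q j) x := by fun_prop (disch := simpa using hx')
    exact this.tendsto.mono_left nhdsWithin_le_nhds
  have hqinf : ∀ j, Tendsto (q j) (cobounded ℂ) (𝓝 0) := fun j => by
    have h1 : Tendsto (fun y : ℂ => (y - a j)⁻¹) (cobounded ℂ) (𝓝 0) :=
      tendsto_inv₀_cobounded.comp (tendsto_sub_const_cobounded (a j))
    have := ((h1.pow 2).const_mul (m j)).add (h1.const_mul (β j))
    simpa [hq, div_eq_mul_inv] using this
  have hmer : MeromorphicOn (fun y => Φ y - ∑ j ∈ J, q j y) Set.univ := fun x _ => by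
    have := hΦ x trivial
    have h2 : MeromorphicAt (fun y => ∑ j ∈ J, q j y) x := by
      refine MeromorphicAt.fun_sum fun j _ => ?_
      simp only [hq]
      fun_prop
    exact this.sub h2
  have := eventually_eq_zero_of_tendsto hmer (fun x => ?_) ?_ x
  · filter_upwards [this] with y hy
    rw [sub_eq_zero] at hy
    rw [hy, ← Finset.sum_add_distrib]
  · by_cases hx : ∀ j ∈ J, a j ≠ x
    · obtain ⟨L, hL⟩ := hreg x hx
      exact ⟨_, hL.sub (tendsto_finsetSum J fun j hj => hqc j x (hx j hj))⟩
    · push Not at hx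
      obtain ⟨i, hi, rfl⟩ := hx
      obtain ⟨L, hL⟩ := hβ i hi
      -- Since the a j are distinct, only the i-th principal part is singular here, and `hL` has
      -- already removed it.
      refine ⟨_, (hL.sub (tendsto_finsetSum (J.erase i) fun j hj =>
        hqc j (a i) fun h => Finset.ne_of_mem_erase hj (ha (Finset.mem_of_mem_erase hj) hi h))).congr
        fun y => ?_⟩
      rw [← Finset.add_sum_erase J _ hi]
      simp only [hq]
      ring
  · simpa using hinf.sub (tendsto_finsetSum J fun j _ => hqinf j)

/-! ### Meromorphic functions on the upper half-plane -/

theorem map_coe_nhdsNE (τ : ℍ) : map ((↑) : ℍ → ℂ) (𝓝[≠] τ) = 𝓝[≠] (τ : ℂ) := by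
  have h := UpperHalfPlane.isOpenEmbedding_coe
  rw [nhdsWithin, map_inf h.injective, h.map_nhds_eq, map_principal, nhdsWithin]
  refine le_antisymm (inf_le_inf_left _ (principal_mono.2 ?_)) (le_inf inf_le_left ?_)
  · rintro _ ⟨σ, hσ, rfl⟩
    exact fun h' => hσ (h.injective h')
  · rw [le_principal_iff]
    filter_upwards [self_mem_nhdsWithin,
      mem_nhdsWithin_of_mem_nhds (h.isOpen_range.mem_nhds ⟨τ, rfl⟩)] with z hz ⟨σ, hσ⟩
    exact ⟨σ, fun h' => hz (by rw [← hσ, Set.mem_singleton_iff.1 h']; rfl), hσ⟩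

theorem eventually_nhdsNE_coe {τ : ℍ} {p : ℂ → Prop} :
    (∀ᶠ z in 𝓝[≠] (τ : ℂ), p z) ↔ ∀ᶠ σ : ℍ in 𝓝[≠] τ, p σ := by
  rw [← map_coe_nhdsNE, eventually_map]

theorem tendsto_nhdsNE_coe {α : Type*} {τ : ℍ} {F : ℂ → α} {l : Filter α} :
    Tendsto F (𝓝[≠] (τ : ℂ)) l ↔ Tendsto (fun σ : ℍ => F σ) (𝓝[≠] τ) l := by
  rw [← map_coe_nhdsNE, tendsto_map'_iff]; rfl

instance nhdsNE_neBot (τ : ℍ) : (𝓝[≠] τ).NeBot := by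
  rw [← map_neBot_iff ((↑) : ℍ → ℂ), map_coe_nhdsNE]
  infer_instance

variable {f : ℍ → ℂ}

theorem IsMeromorphic.meromorphicNFAt (hf : IsMeromorphic f) (τ : ℍ) :
    MeromorphicNFAt (f ∘ ofComplex) τ := hf τ.im_pos

theorem IsMeromorphic.analyticAt (hf : IsMeromorphic f) {τ : ℍ} (h : ¬ IsPole f τ) :
    AnalyticAt ℂ (f ∘ ofComplex) τ :=
  (hf.meromorphicNFAt τ).meromorphicOrderAt_nonneg_iff_analyticAt.1 (not_lt.1 h)

theorem sphereValue_of_isPole {τ : ℍ} (h : IsPole f τ) : sphereValue f τ = ∞ := if_pos h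

theorem sphereValue_of_not_isPole {τ : ℍ} (h : ¬ IsPole f τ) : sphereValue f τ = f τ := if_neg h

theorem sphereValue_eq_infty_iff {τ : ℍ} : sphereValue f τ = ∞ ↔ IsPole f τ := by
  by_cases h : IsPole f τ
  · simp [sphereValue_of_isPole h, h]
  · simp [sphereValue_of_not_isPole h, h]

theorem not_isPole_of_analyticAt {τ : ℍ} (h : AnalyticAt ℂ (f ∘ ofComplex) τ) : ¬ IsPole f τ :=
  not_lt.2 h.meromorphicOrderAt_nonneg

theorem IsMeromorphic.eventually_sphereValue_eq (hf : IsMeromorphic f) (τ : ℍ) :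
    ∀ᶠ σ in 𝓝[≠] τ, sphereValue f σ = f σ := by
  have := eventually_nhdsNE_coe.1 (hf.meromorphicNFAt τ).meromorphicAt.eventually_analyticAt
  exact this.mono fun σ hσ => sphereValue_of_not_isPole (not_isPole_of_analyticAt hσ)

theorem IsMeromorphic.tendsto_sphereValue (hf : IsMeromorphic f) (τ : ℍ) :
    Tendsto (fun σ => (f σ : OnePoint ℂ)) (𝓝[≠] τ) (𝓝 (sphereValue f τ)) := by
  by_cases h : IsPole f τ
  · rw [sphereValue_of_isPole h]
    refine OnePoint.tendsto_coe_infty.comp ?_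
    rw [coclosedCompact_eq_cocompact, ← Metric.cobounded_eq_cocompact]
    have := tendsto_nhdsNE_coe.1 (tendsto_cobounded_of_meromorphicOrderAt_neg h)
    simpa using this
  · rw [sphereValue_of_not_isPole h]
    have := tendsto_nhdsNE_coe.1
      ((hf.analyticAt h).continuousAt.tendsto.mono_left nhdsWithin_le_nhds)
    simp only [Function.comp_apply, UpperHalfPlane.ofComplex_apply] at this
    exact (OnePoint.continuous_coe.tendsto (f τ)).comp this

theorem IsMeromorphic.continuous_sphereValue (hf : IsMeromorphic f) :
    Continuous (sphereValue f) := by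
  refine continuous_iff_continuousAt.2 fun τ => ?_
  rw [continuousAt_iff_punctured_nhds]
  exact (hf.tendsto_sphereValue τ).congr' ((hf.eventually_sphereValue_eq τ).mono fun _ h => h.symm)

/-- `f` is not locally constant at `τ`. -/
def IsNonconstantAt (f : ℍ → ℂ) (τ : ℍ) : Prop := ¬ ∃ c, ∀ᶠ σ in 𝓝[≠] τ, f σ = c

/-- Identity theorem: infinite order of f - c spreads over the connected half-plane. -/
theorem IsMeromorphic.eventually_eq_const (hf : IsMeromorphic f) {τ : ℍ} {c : ℂ}
    (h : ∀ᶠ σ in 𝓝[≠] τ, f σ = c) (τ' : ℍ) : ∀ᶠ σ in 𝓝[≠] τ', f σ = c := by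
  have hmer : MeromorphicOn (fun z => (f ∘ ofComplex) z - c) {z : ℂ | 0 < z.im} := fun z hz =>
    (hf hz).meromorphicAt.sub (MeromorphicAt.const c z)
  have hconn : IsConnected {z : ℂ | 0 < z.im} :=
    ⟨⟨_, UpperHalfPlane.I.im_pos⟩, (convex_halfSpace_im_gt 0).isPreconnected⟩
  have key := (hmer.exists_meromorphicOrderAt_ne_top_iff_forall hconn).not
  have hiff : ∀ σ : ℍ, meromorphicOrderAt (fun z => (f ∘ ofComplex) z - c) σ = ⊤ ↔
      ∀ᶠ ρ in 𝓝[≠] σ, f ρ = c := fun σ => by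
    rw [meromorphicOrderAt_eq_top_iff, eventually_nhdsNE_coe]
    simp [sub_eq_zero]
  push Not at key
  have := key.2 ⟨⟨τ, τ.im_pos⟩, (hiff τ).2 h⟩ ⟨τ', τ'.im_pos⟩
  exact (hiff τ').1 this

theorem IsMeromorphic.isNonconstantAt_of_surjective (hf : IsMeromorphic f)
    (h : Function.Surjective (sphereValue f)) (τ : ℍ) : IsNonconstantAt f τ := by
  rintro ⟨c, hc⟩
  obtain ⟨σ, hσ⟩ := h ∞
  have h1 := hf.tendsto_sphereValue σ
  have h2 : Tendsto (fun σ => (f σ : OnePoint ℂ)) (𝓝[≠] σ) (𝓝 c) :=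
    tendsto_const_nhds.congr' ((hf.eventually_eq_const hc σ).mono fun ρ hρ => by simp only [hρ])
  have := tendsto_nhds_unique h1 h2
  rw [hσ] at this
  exact OnePoint.infty_ne_coe c this

/-- The local form of a nonconstant meromorphic function on the upper half-plane. -/
theorem IsMeromorphic.exists_isLocalForm (hf : IsMeromorphic f) {τ : ℍ}
    (hnc : IsNonconstantAt f τ) :
    ∃ c n v, IsLocalForm (f ∘ ofComplex) τ c n v ∧ (0 < n → ¬ IsPole f τ ∧ f τ = c) ∧
      (n < 0 → IsPole f τ) := by
  obtain ⟨c, n, v, h1, h2, h3⟩ := ShimuraCurve.exists_isLocalForm (hf.meromorphicNFAt τ) (by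
    rintro ⟨c, hc⟩
    rw [eventually_nhdsNE_coe] at hc
    exact hnc ⟨c, by simpa using hc⟩)
  refine ⟨c, n, v, h1, fun h => ⟨fun hp => ?_, by simpa using h2 h⟩, h3.1⟩
  exact absurd (h3.2 hp) h.not_gt

/-- The filter of punctured neighbourhoods in `ℂ` of a point of the sphere. -/
noncomputable def punctured (p : OnePoint ℂ) : Filter ℂ := comap (↑) (𝓝[≠] p)

theorem punctured_infty : punctured ∞ = cobounded ℂ := by
  rw [punctured, OnePoint.nhdsNE_infty_eq, comap_map OnePoint.coe_injective,
    coclosedCompact_eq_cocompact, Metric.cobounded_eq_cocompact]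

theorem punctured_coe (c : ℂ) : punctured c = 𝓝[≠] c := by
  rw [punctured, nhdsWithin, comap_inf, ← OnePoint.isOpenEmbedding_coe.isInducing.nhds_eq_comap,
    comap_principal, nhdsWithin]
  congr 2
  ext x
  simp

/-- The local form c + v^n shows that nearby values approach the value at τ without attaining it. -/
theorem IsMeromorphic.tendsto_punctured (hf : IsMeromorphic f) {τ : ℍ}
    (hnc : IsNonconstantAt f τ) : Tendsto f (𝓝[≠] τ) (punctured (sphereValue f τ)) := by
  obtain ⟨c, n, v, h1, h2, h3⟩ := hf.exists_isLocalForm hnc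
  rcases lt_or_gt_of_ne h1.ne_zero with hn | hn
  · rw [sphereValue_of_isPole (h3 hn), punctured_infty]
    simpa using tendsto_nhdsNE_coe.1 (h1.tendsto_of_neg hn)
  · rw [sphereValue_of_not_isPole (h2 hn).1, (h2 hn).2, punctured_coe]
    simpa using tendsto_nhdsNE_coe.1 (h1.tendsto_of_pos hn)

theorem nhds_le_map_of_analyticAt {F : ℂ → ℂ} {τ : ℍ} (hF : AnalyticAt ℂ F τ)
    (hnc : ¬ ∃ c, ∀ᶠ σ : ℍ in 𝓝[≠] τ, F σ = c) :
    𝓝 (F τ) ≤ map (fun σ : ℍ => F σ) (𝓝 τ) := by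
  have := hF.eventually_constant_or_nhds_le_map_nhds.resolve_left fun h =>
    hnc ⟨F τ, eventually_nhdsNE_coe.1 (h.filter_mono nhdsWithin_le_nhds)⟩
  rwa [← UpperHalfPlane.isOpenEmbedding_coe.map_nhds_eq, map_map] at this

/-- Open mapping theorem, applied to f at finite values and to 1/f at poles. -/
theorem IsMeromorphic.nhds_le_map_sphereValue (hf : IsMeromorphic f) {τ : ℍ}
    (hnc : IsNonconstantAt f τ) : 𝓝 (sphereValue f τ) ≤ map (sphereValue f) (𝓝 τ) := by
  by_cases hp : IsPole f τ
  · have hG := (meromorphicNFAt_inv.2 (hf.meromorphicNFAt τ))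
    have ho : 0 < meromorphicOrderAt (f ∘ ofComplex)⁻¹ (τ : ℂ) := by
      rw [meromorphicOrderAt_inv]
      have hp' : meromorphicOrderAt (f ∘ ofComplex) (τ : ℂ) < 0 := hp
      generalize meromorphicOrderAt (f ∘ ofComplex) (τ : ℂ) = o at hp'
      cases o with
      | top => simp at hp'
      | coe o =>
        have : o < 0 := by exact_mod_cast hp'
        have h2 : (0 : ℤ) < -o := by lia
        exact_mod_cast h2
    have hGa := hG.meromorphicOrderAt_nonneg_iff_analyticAt.1 ho.le
    have hG0 : (f ∘ ofComplex)⁻¹ (τ : ℂ) = 0 := by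
      by_contra h
      exact ho.ne' (hG.meromorphicOrderAt_eq_zero_iff.2 h)
    have hmap := nhds_le_map_of_analyticAt hGa (by
      rintro ⟨c, hc⟩
      exact hnc ⟨c⁻¹, hc.mono fun σ hσ => by simpa [inv_eq_iff_eq_inv] using hσ⟩)
    rw [hG0] at hmap
    rw [sphereValue_of_isPole hp, OnePoint.nhds_infty_eq, coclosedCompact_eq_cocompact,
      ← Metric.cobounded_eq_cocompact]
    refine sup_le ?_ ?_
    · intro s hs
      have hs' : {σ : ℍ | sphereValue f σ ∈ s} ∩ {σ | σ ≠ τ → sphereValue f σ = f σ} ∈ 𝓝 τ :=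
        inter_mem hs (eventually_nhdsWithin_iff.1 (hf.eventually_sphereValue_eq τ))
      have h0 := hmap (image_mem_map hs')
      rw [mem_map, ← inv_nhdsNE_zero, Filter.mem_inv]
      filter_upwards [mem_nhdsWithin_of_mem_nhds h0, self_mem_nhdsWithin] with x hx hx0
      obtain ⟨σ, ⟨hσs, hσ⟩, rfl⟩ := hx
      have hστ : σ ≠ τ := fun h => hx0 (by rw [h]; exact hG0)
      have h1 := hσ hστ
      rw [Set.mem_ofPred_eq, h1] at hσs
      simpa using hσs
    · rw [← sphereValue_of_isPole hp, ← map_pure]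
      exact map_mono (pure_le_nhds τ)
  · have hmap := nhds_le_map_of_analyticAt (hf.analyticAt hp) (by
      rintro ⟨c, hc⟩
      exact hnc ⟨c, by simpa using hc⟩)
    simp only [Function.comp_apply, UpperHalfPlane.ofComplex_apply] at hmap
    rw [sphereValue_of_not_isPole hp, OnePoint.nhds_coe_eq]
    have hev : ∀ᶠ σ in 𝓝 τ, (f σ : OnePoint ℂ) = sphereValue f σ := by
      have := eventually_nhdsWithin_iff.1 (hf.eventually_sphereValue_eq τ)
      filter_upwards [this] with σ hσ
      by_cases h : σ = τ
      · rw [h, sphereValue_of_not_isPole hp]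
      · exact (hσ h).symm
    rw [← map_congr hev]
    exact map_mono hmap

/-! ### The action of `SL(2, ℝ)` -/

theorem exists_gl_smul_eq (g : SL(2, ℝ)) :
    ∃ G : GL (Fin 2) ℝ, 0 < G.val.det ∧ ∀ τ : ℍ, g • τ = G • τ :=
  ⟨Matrix.SpecialLinearGroup.mapGL ℝ g, by simp, fun _ => rfl⟩

/-- A transformation fixing two points is trivial. -/
theorem smul_eq_self_of_fixes_two {g : SL(2, ℝ)} {τ σ : ℍ} (hτσ : τ ≠ σ) (hτ : g • τ = τ)
    (hσ : g • σ = σ) (ρ : ℍ) : g • ρ = ρ := by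
  obtain ⟨G, hG, hgG⟩ := exists_gl_smul_eq g
  simp only [hgG] at *
  by_contra hρ
  have hc : G ∉ Subgroup.center _ := fun h =>
    hρ (UpperHalfPlane.forall_smul_eq_self_iff_mem_center.2 h ρ)
  have hell := UpperHalfPlane.isElliptic_of_exists_smul_eq_self hG hc ⟨τ, hτ⟩
  rw [UpperHalfPlane.gl_smul_eq_self_iff_eq_fixedPt hG hell] at hτ hσ
  exact hτσ (hτ.trans hσ.symm)

variable {Γ : Subgroup SL(2, ℝ)} {t : ℍ → ℂ}

theorem IsAutomorphicFunction.isPole_smul_iff (hf : IsAutomorphicFunction Γ f) {γ : SL(2, ℝ)}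
    (hγ : γ ∈ Γ) (τ : ℍ) : IsPole f (γ • τ) ↔ IsPole f τ := by
  obtain ⟨G, hG, hgG⟩ := exists_gl_smul_eq γ
  have h := UpperHalfPlane.meromorphicOrderAt_comp_smul (f := f) (τ := τ) hG
  rw [IsPole, IsPole, hgG]
  simp only [← hgG, hf.2 γ hγ] at h ⊢
  exact iff_of_eq (congrArg (· < 0) h.symm)

theorem IsAutomorphicFunction.sphereValue_smul (hf : IsAutomorphicFunction Γ f) {γ : SL(2, ℝ)}
    (hγ : γ ∈ Γ) (τ : ℍ) : sphereValue f (γ • τ) = sphereValue f τ := by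
  by_cases h : IsPole f τ
  · rw [sphereValue_of_isPole h, sphereValue_of_isPole ((hf.isPole_smul_iff hγ τ).2 h)]
  · rw [sphereValue_of_not_isPole h,
      sphereValue_of_not_isPole (mt (hf.isPole_smul_iff hγ τ).1 h), hf.2 γ hγ]

/-! ### Hauptmoduln -/

theorem eventually_nhdsNE_of_codiscrete {α : Type*} {f g : ℍ → α}
    (h : f =ᶠ[codiscrete ℍ] g) (τ : ℍ) : ∀ᶠ σ in 𝓝[≠] τ, f σ = g σ := by
  have := mem_codiscreteWithin_iff_forall_mem_nhdsNE.1 h τ trivial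
  rwa [Set.compl_univ, Set.union_empty] at this

theorem exists_tendsto_punctured_ratFunc_eval (R : RatFunc ℂ) (p : OnePoint ℂ) :
    ∃ L : OnePoint ℂ, Tendsto (fun x => ((R.eval (RingHom.id ℂ) x : ℂ) : OnePoint ℂ))
      (punctured p) (𝓝 L) := by
  induction p using OnePoint.rec with
  | infty =>
    rw [punctured_infty]
    exact exists_tendsto_cobounded_of_meromorphicAt
      (RatFunc.meromorphicAt_eval R (MeromorphicAt.id 0).inv)
  | coe c =>
    rw [punctured_coe]
    exact MeromorphicAt.exists_tendsto_onePoint (RatFunc.meromorphicAt_eval R (MeromorphicAt.id c))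

/-- The genus zero map is a rational function of t, so if t were locally constant, that surjective
map would be too. -/
theorem IsHauptmodul.isNonconstantAt (hgenus : HasGenusZero Γ) (ht : IsHauptmodul Γ t) (τ : ℍ) :
    IsNonconstantAt t τ := by
  obtain ⟨f, hf, -, hsurj⟩ := hgenus
  obtain ⟨R, hR⟩ := ht.2 f hf
  rintro ⟨c, hc⟩
  refine hf.1.isNonconstantAt_of_surjective hsurj τ ⟨R.eval (RingHom.id ℂ) c, ?_⟩
  filter_upwards [hc, eventually_nhdsNE_of_codiscrete hR τ] with σ h1 h2
  rw [h2, h1]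

/-- A Hauptmodul separates the orbits. -/
theorem IsHauptmodul.exists_smul_eq (hgenus : HasGenusZero Γ) (ht : IsHauptmodul Γ t) {τ σ : ℍ}
    (h : sphereValue t τ = sphereValue t σ) : ∃ γ ∈ Γ, γ • τ = σ := by
  have hnc := ht.isNonconstantAt hgenus
  obtain ⟨f, hf, hinj, -⟩ := hgenus
  obtain ⟨R, hR⟩ := ht.2 f hf
  obtain ⟨L, hL⟩ := exists_tendsto_punctured_ratFunc_eval R (sphereValue t τ)
  -- The value of f = R(t) at ρ is the limit of R at the value of t, so points not separated by t
  -- are not separated by f.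
  have key : ∀ ρ, sphereValue t ρ = sphereValue t τ → sphereValue f ρ = L := fun ρ hρ => by
    rw [← hρ] at hL
    refine tendsto_nhds_unique (hf.1.tendsto_sphereValue ρ)
      ((hL.comp (ht.1.1.tendsto_punctured (hnc ρ))).congr' ?_)
    filter_upwards [eventually_nhdsNE_of_codiscrete hR ρ] with x hx
    rw [hx]; rfl
  exact hinj τ σ ((key τ rfl).trans (key σ h.symm).symm)

theorem IsMeromorphic.isOpenMap_sphereValue (hf : IsMeromorphic f)
    (hnc : ∀ τ, IsNonconstantAt f τ) : IsOpenMap (sphereValue f) :=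
  IsOpenMap.of_nhds_le fun τ => hf.nhds_le_map_sphereValue (hnc τ)

/-- In genus zero, nonconstant automorphic functions take all values. -/
theorem IsAutomorphicFunction.surjective_sphereValue (hgenus : HasGenusZero Γ)
    (ht : IsAutomorphicFunction Γ t) (hnc : ∀ τ, IsNonconstantAt t τ) :
    Function.Surjective (sphereValue t) := by
  obtain ⟨f, hf, hinj, hsurj⟩ := hgenus
  have hq : IsOpenQuotientMap (sphereValue f) := ⟨hsurj, hf.1.continuous_sphereValue,
    hf.1.isOpenMap_sphereValue (hf.1.isNonconstantAt_of_surjective hsurj)⟩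
  -- The section s need not be continuous, but t ∘ s is, because f is a quotient map with orbits as
  -- fibres. The image of t is then compact and open in the connected sphere.
  obtain ⟨s, hs⟩ := hsurj.hasRightInverse
  have hfac : ∀ τ, sphereValue t (s (sphereValue f τ)) = sphereValue t τ := fun τ => by
    obtain ⟨γ, hγ, hγτ⟩ := hinj _ _ (hs (sphereValue f τ)).symm
    rw [← hγτ, ht.sphereValue_smul hγ]
  have hcont : Continuous (sphereValue t ∘ s) := by
    rw [hq.isQuotientMap.continuous_iff]
    exact ht.1.continuous_sphereValue.congr fun τ => (hfac τ).symm
  have hrange : Set.range (sphereValue t) = Set.range (sphereValue t ∘ s) := by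
    ext x
    constructor
    · rintro ⟨τ, rfl⟩
      exact ⟨_, hfac τ⟩
    · rintro ⟨y, rfl⟩
      exact ⟨_, rfl⟩
  have hclopen : IsClopen (Set.range (sphereValue t)) :=
    ⟨hrange ▸ (isCompact_range hcont).isClosed, (ht.1.isOpenMap_sphereValue hnc).isOpen_range⟩
  exact Set.range_eq_univ.1 (hclopen.eq_univ ⟨_, UpperHalfPlane.I, rfl⟩)

/-! ### Elliptic points -/

theorem pointOrder_eq_one_of_not_isEllipticPoint {τ : ℍ} (h : ¬ IsEllipticPoint Γ τ) :
    pointOrder Γ τ = 1 := by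
  have : (MulAction.stabilizer Γ τ).map (MulAction.toPermHom Γ ℍ) = ⊥ := by
    rw [eq_bot_iff]
    rintro _ ⟨γ, hγ, rfl⟩
    rw [Subgroup.mem_bot]
    ext1 σ
    by_contra hσ
    exact h ⟨γ, γ.2, hγ, σ, hσ⟩
  rw [pointOrder, this, Subgroup.card_bot]

theorem IsEllipticPoint.smul {τ : ℍ} (h : IsEllipticPoint Γ τ) {γ : SL(2, ℝ)} (hγ : γ ∈ Γ) :
    IsEllipticPoint Γ (γ • τ) := by
  obtain ⟨δ, hδ, hδτ, σ, hσ⟩ := h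
  refine ⟨γ * δ * γ⁻¹, Γ.mul_mem (Γ.mul_mem hγ hδ) (Γ.inv_mem hγ), ?_, γ • σ, ?_⟩
  · simp only [mul_smul, inv_smul_smul, hδτ]
  · simp only [mul_smul, inv_smul_smul]
    exact fun h => hσ (MulAction.injective γ h)

theorem pow_natAbs_eq_one_iff {x : ℂ} {n : ℤ} : x ^ n.natAbs = 1 ↔ x ^ n = 1 := by
  cases n <;> simp

/-- The ramification index at `τ` of an automorphic function separating the orbits is the order of
the point `τ`. -/
theorem pointOrder_eq_natAbs (ht : IsAutomorphicFunction Γ t) (hnc : ∀ τ, IsNonconstantAt t τ)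
    (hinj : ∀ τ σ, sphereValue t τ = sphereValue t σ → ∃ γ ∈ Γ, γ • τ = σ)
    {τ : ℍ} {c : ℂ} {n : ℤ} {v : ℂ → ℂ} (h : IsLocalForm (t ∘ ofComplex) τ c n v) :
    pointOrder Γ τ = n.natAbs := by
  set N := n.natAbs with hN
  have hN0 : N ≠ 0 := Int.natAbs_ne_zero.2 h.ne_zero
  have hcoe := UpperHalfPlane.isOpenEmbedding_coe
  obtain ⟨s, hs, hsinj⟩ := h.exists_injOn
  have hnear : ∀ᶠ σ : ℍ in 𝓝 τ, (σ : ℂ) ∈ s ∧ (σ ≠ τ → t σ = c + v σ ^ n ∧ v σ ≠ 0 ∧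
      sphereValue t σ = t σ ∧ sphereValue t σ ≠ sphereValue t τ) := by
    have h1 := eventually_nhdsWithin_iff.1 (eventually_nhdsNE_coe.1 h.eventually_eq)
    have h2 := eventually_nhdsWithin_iff.1 (eventually_nhdsNE_coe.1 h.eventually_coordinate_ne)
    have h3 := eventually_nhdsWithin_iff.1 (ht.1.eventually_sphereValue_eq τ)
    have h4 : ∀ᶠ σ in 𝓝[≠] τ, (t σ : OnePoint ℂ) ≠ sphereValue t τ :=
      tendsto_comap_iff.1 (ht.1.tendsto_punctured (hnc τ)) self_mem_nhdsWithin
    filter_upwards [h1, h2, h3, eventually_nhdsWithin_iff.1 h4,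
      hcoe.continuous.continuousAt.preimage_mem_nhds hs] with σ a1 a2 a3 a4 a5
    refine ⟨a5, fun hσ => ⟨by simpa using a1 hσ, a2 hσ, a3 hσ, ?_⟩⟩
    rw [a3 hσ]
    exact a4 hσ
  obtain ⟨ε, hε, hball⟩ := Metric.eventually_nhds_iff_ball.1 hnear
  have hvinj : ∀ σ ∈ Metric.ball τ ε, ∀ ρ ∈ Metric.ball τ ε, v σ = v ρ → σ = ρ :=
    fun σ hσ ρ hρ hv => hcoe.injective (hsinj (hball σ hσ).1 (hball ρ hρ).1 hv)
  -- Proper discontinuity: since Γ acts by isometries, γ • τ lies within ε of τ, where only τ takes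
  -- the value of t at τ.
  have hfix : ∀ γ ∈ Γ, ∀ σ ∈ Metric.ball τ (ε / 2), γ • σ ∈ Metric.ball τ (ε / 2) →
      γ • τ = τ := by
    intro γ hγ σ hσ hγσ
    by_contra hne
    refine (hball (γ • τ) ?_).2 hne |>.2.2.2 (ht.sphereValue_smul hγ τ)
    rw [Metric.mem_ball] at *
    calc dist (γ • τ) τ ≤ dist (γ • τ) (γ • σ) + dist (γ • σ) τ := dist_triangle _ _ _
      _ = dist σ τ + dist (γ • σ) τ := by rw [dist_smul, dist_comm]
      _ < ε := by linarith
  have hhalf : Metric.ball τ (ε / 2) ⊆ Metric.ball τ ε := Metric.ball_subset_ball (half_le_self hε.le)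
  have himage : (fun σ : ℍ => v σ) '' Metric.ball τ (ε / 2) ∈ 𝓝 (0 : ℂ) := by
    rw [← h.map_nhds_coordinate, ← hcoe.map_nhds_eq, map_map]
    exact image_mem_map (Metric.ball_mem_nhds τ (half_pos hε))
  obtain ⟨δ, hδ, hδball⟩ := Metric.mem_nhds_iff.1 himage
  obtain ⟨σ, hσ, hσδ, hστ⟩ : ∃ σ ∈ Metric.ball τ (ε / 2), ‖v σ‖ < δ ∧ σ ≠ τ := by
    have h1 := tendsto_nhdsNE_coe.1 (tendsto_nhds_of_tendsto_nhdsWithin h.tendsto_coordinate)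
    have h2 : ∀ᶠ σ : ℍ in 𝓝[≠] τ, ‖v σ‖ < δ := by
      filter_upwards [h1 (Metric.ball_mem_nhds 0 hδ)] with σ hσ
      simpa using hσ
    obtain ⟨σ, a, b, c⟩ := (h2.and ((Filter.eventually_of_mem (mem_nhdsWithin_of_mem_nhds
      (Metric.ball_mem_nhds τ (half_pos hε))) fun _ => id).and self_mem_nhdsWithin)).exists
    exact ⟨σ, b, a, c⟩
  obtain ⟨htσ, hvσ, hsσ, -⟩ := (hball σ (hhalf hσ)).2 hστ
  have hmove : ∀ γ ∈ Γ, γ • τ = τ → γ • σ ∈ Metric.ball τ (ε / 2) ∧ γ • σ ≠ τ := by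
    intro γ hγ hγτ
    refine ⟨?_, fun hγσ => hστ (MulAction.injective γ (hγσ.trans hγτ.symm))⟩
    rw [Metric.mem_ball] at *
    rwa [← hγτ, dist_smul]
  have hroot : ∀ γ ∈ Γ, γ • τ = τ → (v ↑(γ • σ) / v σ) ^ N = 1 := by
    intro γ hγ hγτ
    obtain ⟨h1, h2⟩ := hmove γ hγ hγτ
    have h3 := ((hball _ (hhalf h1)).2 h2).1
    rw [ht.2 γ hγ, htσ] at h3
    rw [hN, pow_natAbs_eq_one_iff, div_zpow, ← add_left_cancel h3, div_self (zpow_ne_zero n hvσ)]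
  have hcard : (Polynomial.nthRootsFinset N (1 : ℂ)).card = N :=
    (Complex.isPrimitiveRoot_exp N hN0).card_nthRootsFinset
  have hmem : ∀ x : ℂ, x ∈ Polynomial.nthRootsFinset N (1 : ℂ) ↔ x ^ N = 1 := fun x =>
    Polynomial.mem_nthRootsFinset (Nat.pos_of_ne_zero hN0) 1
  set G := (MulAction.stabilizer Γ τ).map (MulAction.toPermHom Γ ℍ) with hG
  have hGmem : ∀ g ∈ G, ∃ γ ∈ Γ, γ • τ = τ ∧ ∀ ρ, g ρ = γ • ρ := by
    rintro _ ⟨γ, hγ, rfl⟩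
    exact ⟨γ, γ.2, hγ, fun _ => rfl⟩
  -- The stabilizer is counted by its orbit of the reference point σ: invariance of t forces v^n to
  -- be unchanged, so the coordinate is multiplied by an N-th root of unity.
  let φ : G → Polynomial.nthRootsFinset N (1 : ℂ) := fun g => ⟨v ↑(g.1 σ) / v σ, by
    obtain ⟨γ, hγ, hγτ, h1⟩ := hGmem g.1 g.2
    rw [hmem, h1]
    exact hroot γ hγ hγτ⟩
  have hφ : Function.Bijective φ := by
    constructor
    · intro g g' hgg'
      obtain ⟨γ, hγ, hγτ, h1⟩ := hGmem g.1 g.2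
      obtain ⟨γ', hγ', hγτ', h1'⟩ := hGmem g'.1 g'.2
      have h2 : v ↑(g.1 σ) / v σ = v ↑(g'.1 σ) / v σ := congrArg Subtype.val hgg'
      rw [div_left_inj' hvσ, h1, h1'] at h2
      have h3 := hvinj _ (hhalf (hmove γ hγ hγτ).1) _ (hhalf (hmove γ' hγ' hγτ').1) h2
      refine Subtype.ext (Equiv.ext fun ρ => ?_)
      rw [h1, h1', ← inv_smul_eq_iff, smul_smul]
      refine smul_eq_self_of_fixes_two hστ.symm ?_ ?_ ρ
      · rw [mul_smul, hγτ, inv_smul_eq_iff, hγτ']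
      · rw [mul_smul, h3, inv_smul_smul]
    · rintro ⟨ζ, hζ⟩
      rw [hmem] at hζ
      have hζ1 : ‖ζ‖ = 1 := Complex.norm_eq_one_of_pow_eq_one hζ hN0
      -- Every root ζ occurs: the point ρ with coordinate ζ v(σ) has the same value of t as σ, hence
      -- is γ • σ, and γ must fix τ by `hfix`.
      obtain ⟨ρ, hρ, hvρ⟩ : ζ * v σ ∈ (fun σ : ℍ => v σ) '' Metric.ball τ (ε / 2) :=
        hδball (by simpa [hζ1] using hσδ)
      simp only at hvρ
      have hρτ : ρ ≠ τ := by
        rintro rfl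
        rw [h.map_zero] at hvρ
        refine mul_ne_zero (fun hζ0 => ?_) hvσ hvρ.symm
        rw [hζ0, zero_pow hN0] at hζ
        exact zero_ne_one hζ
      obtain ⟨htρ, -, hsρ, -⟩ := (hball ρ (hhalf hρ)).2 hρτ
      have htt : sphereValue t σ = sphereValue t ρ := by
        rw [hsσ, hsρ, htσ, htρ, hvρ, mul_zpow, pow_natAbs_eq_one_iff.1 hζ, one_mul]
      obtain ⟨γ, hγ, hγσ⟩ := hinj σ ρ htt
      have hγτ := hfix γ hγ σ hσ (hγσ ▸ hρ)
      refine ⟨⟨MulAction.toPermHom Γ ℍ ⟨γ, hγ⟩, ⟨γ, hγ⟩, hγτ, rfl⟩, Subtype.ext ?_⟩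
      change v ↑(γ • σ) / v σ = ζ
      rw [hγσ, hvρ, mul_div_cancel_right₀ _ hvσ]
  rw [pointOrder, Nat.card_eq_of_bijective φ hφ, Nat.card_eq_fintype_card, Fintype.card_coe, hcard]

/-! ### Invariance of the automorphic derivative -/

/-- The cocycle rule, from the chain rule up to third order. -/
theorem schwarzian_comp {F M : ℂ → ℂ} {z : ℂ} (hM : AnalyticAt ℂ M z) (hF : AnalyticAt ℂ F (M z))
    (hM1 : deriv M z ≠ 0) (hF1 : deriv F (M z) ≠ 0) :
    deriv (F ∘ M) z = deriv F (M z) * deriv M z ∧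
    schwarzian (F ∘ M) z = schwarzian F (M z) * deriv M z ^ 2 + schwarzian M z := by
  have hev : ∀ᶠ x in 𝓝 z, AnalyticAt ℂ M x ∧ AnalyticAt ℂ F (M x) :=
    hM.eventually_analyticAt.and (hM.continuousAt.eventually hF.eventually_analyticAt)
  have hcomp : ∀ {G : ℂ → ℂ} {x : ℂ}, AnalyticAt ℂ G (M x) → AnalyticAt ℂ M x →
      HasDerivAt (fun y => G (M y)) (deriv G (M x) * deriv M x) x := fun hG hx =>
    hG.differentiableAt.hasDerivAt.comp _ hx.differentiableAt.hasDerivAt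
  have hd1 : deriv (F ∘ M) =ᶠ[𝓝 z] fun x => deriv F (M x) * deriv M x := by
    filter_upwards [hev] with x hx
    exact (hcomp hx.2 hx.1).deriv
  have hd2 : deriv (deriv (F ∘ M)) =ᶠ[𝓝 z] fun x =>
      deriv (deriv F) (M x) * deriv M x * deriv M x + deriv F (M x) * deriv (deriv M) x := by
    refine hd1.deriv.trans ?_
    filter_upwards [hev] with x hx
    exact ((hcomp hx.2.deriv hx.1).mul hx.1.deriv.differentiableAt.hasDerivAt).deriv
  have hd3 : deriv (deriv (deriv (F ∘ M))) z =
      deriv (deriv (deriv F)) (M z) * deriv M z ^ 3 +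
        3 * deriv (deriv F) (M z) * deriv M z * deriv (deriv M) z +
        deriv F (M z) * deriv (deriv (deriv M)) z := by
    rw [hd2.deriv_eq]
    have e1 := hM.deriv.differentiableAt.hasDerivAt
    have e2 := hM.deriv.deriv.differentiableAt.hasDerivAt
    have := ((((hcomp hF.deriv.deriv hM).mul e1).mul e1).add ((hcomp hF.deriv hM).mul e2)).deriv
    refine Eq.trans this ?_
    simp only [Pi.mul_apply]
    ring
  refine ⟨hd1.self_of_nhds, ?_⟩
  rw [schwarzian, schwarzian, schwarzian, hd3, hd2.self_of_nhds, hd1.self_of_nhds]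
  field_simp
  ring

/-- The Schwarzian derivative of a Möbius transformation is zero. -/
theorem schwarzian_smul_eq_zero {G : GL (Fin 2) ℝ} (hG : 0 < G.val.det) (τ : ℍ) :
    schwarzian (fun z => (↑(G • ofComplex z) : ℂ)) τ = 0 := by
  set M : ℂ → ℂ := fun z => ↑(G • ofComplex z)
  have hden : UpperHalfPlane.denom G τ ≠ 0 := UpperHalfPlane.denom_ne_zero G τ
  have hev : ∀ {p : ℂ → Prop}, (∀ σ : ℍ, p σ) → ∀ᶠ z in 𝓝 (τ : ℂ), p z := fun hp => by
    rw [← UpperHalfPlane.isOpenEmbedding_coe.map_nhds_eq, eventually_map]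
    exact Eventually.of_forall hp
  have hd1 : deriv M =ᶠ[𝓝 (τ : ℂ)] fun z => G.val.det * UpperHalfPlane.denom G z ^ (-2 : ℤ) := by
    refine hev fun σ => ?_
    rw [UpperHalfPlane.deriv_smul hG σ]
    rfl
  have hd2 : deriv (deriv M) =ᶠ[𝓝 (τ : ℂ)] fun z =>
      G.val.det * (-2 * G 1 0) * UpperHalfPlane.denom G z ^ (-3 : ℤ) := by
    refine hd1.deriv.trans (hev fun σ => ?_)
    rw [((UpperHalfPlane.hasDerivAt_denom_zpow G (-2) σ).const_mul _).deriv]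
    push_cast
    ring_nf
  have hd3 : deriv (deriv (deriv M)) τ =
      G.val.det * (6 * G 1 0 ^ 2) * UpperHalfPlane.denom G τ ^ (-4 : ℤ) := by
    rw [hd2.deriv_eq, ((UpperHalfPlane.hasDerivAt_denom_zpow G (-3) τ).const_mul _).deriv]
    push_cast
    ring_nf
  have hdet : ((G.val.det : ℝ) : ℂ) ≠ 0 := by exact_mod_cast hG.ne'
  rw [schwarzian, hd3, hd2.self_of_nhds, hd1.self_of_nhds]
  simp only [zpow_neg]
  norm_cast
  field_simp
  norm_num
  ring

/-- {M} = 0, so both the Schwarzian and F'^2 acquire the factor M'^2, which cancels in the quotient.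
-/
theorem automorphicDerivative_comp_smul {F : ℂ → ℂ} {G : GL (Fin 2) ℝ} (hG : 0 < G.val.det) {τ : ℍ}
    (hF : AnalyticAt ℂ F ↑(G • τ)) (hF1 : deriv F ↑(G • τ) ≠ 0) :
    automorphicDerivative (fun z => F ↑(G • ofComplex z)) τ =
      automorphicDerivative F ↑(G • τ) := by
  set M : ℂ → ℂ := fun z => ↑(G • ofComplex z) with hM
  have hMτ : M τ = ↑(G • τ) := by simp [hM]
  have hM1 := UpperHalfPlane.deriv_smul_ne_zero hG τ
  obtain ⟨h1, h2⟩ := schwarzian_comp (F := F) (M := M) (UpperHalfPlane.analyticAt_smul hG τ)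
    (by rwa [hMτ]) hM1 (by rwa [hMτ])
  change automorphicDerivative (F ∘ M) τ = _
  rw [automorphicDerivative, automorphicDerivative, h1, h2, schwarzian_smul_eq_zero hG τ, hMτ]
  have hM1' : deriv M τ ≠ 0 := hM1
  field_simp
  simp

theorem IsMeromorphic.eventually_deriv_ne_zero (hf : IsMeromorphic f) {τ : ℍ}
    (hnc : IsNonconstantAt f τ) :
    ∀ᶠ σ : ℍ in 𝓝[≠] τ, ¬ IsPole f σ ∧ deriv (f ∘ ofComplex) σ ≠ 0 := by
  obtain ⟨c, n, v, h, -, -⟩ := hf.exists_isLocalForm hnc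
  have hn : (n : ℂ) ≠ 0 := by exact_mod_cast h.ne_zero
  have key : ∀ᶠ z in 𝓝[≠] (τ : ℂ), deriv (f ∘ ofComplex) z ≠ 0 := by
    filter_upwards [eventually_eventually_nhdsWithin.2 h.eventually_eq,
      h.eventually_coordinate_ne, self_mem_nhdsWithin,
      h.analyticAt.eventually_analyticAt.filter_mono nhdsWithin_le_nhds,
      (h.analyticAt.deriv.continuousAt.eventually_ne h.deriv_ne_zero).filter_mono
        nhdsWithin_le_nhds] with z hz h0 hzw hv h1
    rw [isOpen_compl_singleton.nhdsWithin_eq hzw] at hz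
    have hz' : f ∘ ofComplex =ᶠ[𝓝 z] fun x => c + v x ^ n := hz
    rw [hz'.deriv_eq, (schwarzian_const_add_zpow c h.ne_zero hv h0 h1).1]
    exact mul_ne_zero (mul_ne_zero hn (zpow_ne_zero _ h0)) h1
  filter_upwards [eventually_nhdsNE_coe.1 key,
    eventually_nhdsNE_coe.1 (hf.meromorphicNFAt τ).meromorphicAt.eventually_analyticAt]
    with σ h1 h2
  exact ⟨not_isPole_of_analyticAt h2, h1⟩

theorem IsAutomorphicFunction.automorphicDerivative_smul (ht : IsAutomorphicFunction Γ t)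
    {γ : SL(2, ℝ)} (hγ : γ ∈ Γ) {τ : ℍ} (hp : ¬ IsPole t τ) (h1 : deriv (t ∘ ofComplex) τ ≠ 0) :
    automorphicDerivative (t ∘ ofComplex) ↑(γ • τ) = automorphicDerivative (t ∘ ofComplex) τ := by
  obtain ⟨G, hG, hgG⟩ := exists_gl_smul_eq γ
  have hinv : (fun z => (t ∘ ofComplex) ↑(G • ofComplex z)) = t ∘ ofComplex := by
    ext z
    simp only [Function.comp_apply, UpperHalfPlane.ofComplex_apply, ← hgG, ht.2 γ hγ]
  have ha : AnalyticAt ℂ (t ∘ ofComplex) ↑(G • τ) :=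
    ht.1.analyticAt (by rw [← hgG]; exact mt (ht.isPole_smul_iff hγ τ).1 hp)
  have hM := UpperHalfPlane.analyticAt_smul hG τ
  have hd : deriv (t ∘ ofComplex) ↑(G • τ) ≠ 0 := by
    intro h0
    have h2 : HasDerivAt (t ∘ ofComplex) (deriv (t ∘ ofComplex) ↑(G • τ))
        ((fun z : ℂ => (↑(G • ofComplex z) : ℂ)) τ) := by
      simpa using ha.differentiableAt.hasDerivAt
    have h3 := (h2.comp (τ : ℂ) hM.differentiableAt.hasDerivAt).deriv
    rw [h0, zero_mul] at h3
    refine h1 (Eq.trans ?_ h3)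
    exact congrArg (deriv · (τ : ℂ)) hinv.symm
  rw [hgG, ← automorphicDerivative_comp_smul hG ha hd, hinv]

/-- The automorphic derivative, in normal form, is an automorphic function. -/
theorem IsAutomorphicFunction.exists_automorphicDerivative (ht : IsAutomorphicFunction Γ t)
    (hnc : ∀ τ, IsNonconstantAt t τ) :
    ∃ g : ℍ → ℂ, IsAutomorphicFunction Γ g ∧
      ∀ τ : ℍ, ∀ᶠ σ : ℍ in 𝓝[≠] τ, g σ = automorphicDerivative (t ∘ ofComplex) σ := by
  set D := automorphicDerivative (t ∘ ofComplex)
  set U : Set ℂ := {z : ℂ | 0 < z.im}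
  have hD : MeromorphicOn D U := fun z hz =>
    meromorphicAt_automorphicDerivative (ht.1 hz).meromorphicAt
  set H := toMeromorphicNFOn D U
  have hHD : ∀ τ : ℍ, H =ᶠ[𝓝[≠] (τ : ℂ)] D := fun τ =>
    hD.toMeromorphicNFOn_eq_self_on_nhdsNE τ.im_pos
  have hH : ∀ τ : ℍ, MeromorphicNFAt H τ := fun τ =>
    meromorphicNFOn_toMeromorphicNFOn D U τ.im_pos
  refine ⟨fun τ => H τ, ⟨fun z hz => ?_, fun γ hγ τ => ?_⟩, fun τ => eventually_nhdsNE_coe.1 (hHD τ)⟩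
  · refine (meromorphicNFAt_congr ?_).2 (hH ⟨z, hz⟩)
    filter_upwards [UpperHalfPlane.eventuallyEq_coe_comp_ofComplex hz] with x hx
    exact congrArg H hx
  · obtain ⟨G, hG, hgG⟩ := exists_gl_smul_eq γ
    set M : ℂ → ℂ := fun z => ↑(G • ofComplex z)
    have hM : AnalyticAt ℂ M τ := UpperHalfPlane.analyticAt_smul hG τ
    have hMτ : M τ = ↑(γ • τ) := by simp [M, hgG]
    have hMt : Tendsto M (𝓝[≠] (τ : ℂ)) (𝓝[≠] ↑(γ • τ)) := by
      rw [← hMτ]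
      exact hM.differentiableAt.hasDerivAt.tendsto_nhdsNE (UpperHalfPlane.deriv_smul_ne_zero hG τ)
    have hcomp : MeromorphicNFAt (H ∘ M) τ := by
      refine MeromorphicNFAt.comp_analyticAt ?_ hM
      rw [hMτ]
      exact hH (γ • τ)
    have heq : H ∘ M =ᶠ[𝓝[≠] (τ : ℂ)] H := by
      have h1 := hMt.eventually (hHD (γ • τ))
      refine eventually_nhdsNE_coe.2 ?_
      filter_upwards [eventually_nhdsNE_coe.1 h1, eventually_nhdsNE_coe.1 (hHD τ),
        ht.1.eventually_deriv_ne_zero (hnc τ)] with σ h1 h2 h3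
      rw [Function.comp_apply, h1, h2]
      have hMσ : M σ = ↑(γ • σ) := by simp [M, hgG]
      rw [hMσ]
      exact ht.automorphicDerivative_smul hγ h3.1 h3.2
    -- Invariance is known only off the poles and critical points of t; two functions in normal form
    -- agreeing on a punctured neighbourhood also agree at its centre.
    have := ((hcomp.eventuallyEq_nhdsNE_iff_eventuallyEq_nhds (hH τ)).1 heq).self_of_nhds
    rwa [Function.comp_apply, hMτ] at this

/-! ### Asymptotics of partial fractions -/

section Asymptotics

variable {α ι : Type*} {k : Filter α} {T : α → ℂ} (J : Finset ι) (a m β : ι → ℂ)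

theorem tendsto_inv_sub (hT : Tendsto T k (cobounded ℂ)) (c : ℂ) :
    Tendsto (fun z => (T z - c)⁻¹) k (𝓝 0) :=
  tendsto_inv₀_cobounded.comp ((tendsto_sub_const_cobounded c).comp hT)

theorem eventually_forall_ne (hT : Tendsto T k (cobounded ℂ)) :
    ∀ᶠ z in k, ∀ j ∈ J, T z - a j ≠ 0 := by
  rw [eventually_all_finset]
  intro j _
  have := ((tendsto_sub_const_cobounded (a j)).comp hT).eventually (eventually_ne_cobounded 0)
  exact this

variable [k.NeBot]

/-- A sum of principal parts `P` such that `P * T ^ 2` is bounded at infinity. -/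
theorem sum_eq_of_tendsto_mul_sq (hT : Tendsto T k (cobounded ℂ)) {ℓ : ℂ}
    (h : Tendsto (fun z => (∑ j ∈ J, m j / (T z - a j) ^ 2 + ∑ j ∈ J, β j / (T z - a j)) * T z ^ 2)
      k (𝓝 ℓ)) :
    ∑ j ∈ J, β j = 0 ∧ ∑ j ∈ J, (a j * β j + m j) = ℓ := by
  have hu := fun j => tendsto_inv_sub hT (a j)
  have hne := eventually_forall_ne J a hT
  have hT0 : Tendsto (fun z => (T z)⁻¹) k (𝓝 0) := tendsto_inv₀_cobounded.comp hT
  have hTne : ∀ᶠ z in k, T z ≠ 0 := hT.eventually (eventually_ne_cobounded 0)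
  have h1 : ∑ j ∈ J, β j = 0 := by
    have e1 := h.mul hT0
    rw [mul_zero] at e1
    -- This is P T, rewritten through T/(T - a) = 1 + a/(T - a); its limit is the coefficient of 1/T
    -- at infinity.
    have e2 : Tendsto (fun z => ∑ j ∈ J, (m j * ((T z - a j)⁻¹ * (1 + a j * (T z - a j)⁻¹)) +
        β j * (1 + a j * (T z - a j)⁻¹))) k
        (𝓝 (∑ j ∈ J, (m j * (0 * (1 + a j * 0)) + β j * (1 + a j * 0)))) :=
      tendsto_finsetSum J fun j _ => (((hu j).mul (((hu j).const_mul (a j)).const_add 1)).const_mul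
        (m j)).add ((((hu j).const_mul (a j)).const_add 1).const_mul (β j))
    have e3 := tendsto_nhds_unique (e1.congr' ?_) e2
    · simpa using e3.symm
    · filter_upwards [hne, hTne] with z hz hz0
      rw [← Finset.sum_add_distrib, Finset.sum_mul, Finset.sum_mul]
      refine Finset.sum_congr rfl fun j hj => ?_
      have := hz j hj
      field_simp
      ring
  refine ⟨h1, ?_⟩
  have e2 : Tendsto (fun z => ∑ j ∈ J, (m j * (1 + a j * (T z - a j)⁻¹) ^ 2 +
      β j * a j * (1 + a j * (T z - a j)⁻¹))) k
      (𝓝 (∑ j ∈ J, (m j * (1 + a j * 0) ^ 2 + β j * a j * (1 + a j * 0)))) :=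
    tendsto_finsetSum J fun j _ => (((((hu j).const_mul (a j)).const_add 1).pow 2).const_mul
      (m j)).add ((((hu j).const_mul (a j)).const_add 1).const_mul (β j * a j))
  have e3 := tendsto_nhds_unique (h.congr' ?_) e2
  · rw [e3]
    refine Finset.sum_congr rfl fun j _ => ?_
    ring
  · filter_upwards [hne] with z hz
    have e4 : ∑ j ∈ J, β j * T z = 0 := by rw [← Finset.sum_mul, h1, zero_mul]
    rw [← sub_zero ((_ : ℂ) * _), ← e4, ← Finset.sum_add_distrib, Finset.sum_mul,
      ← Finset.sum_sub_distrib]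
    refine Finset.sum_congr rfl fun j hj => ?_
    have := hz j hj
    field_simp
    ring

/-- A sum of principal parts `P` such that `P * T ^ 4` is bounded at infinity. -/
theorem sum_eq_zero_of_tendsto_mul_pow_four (hT : Tendsto T k (cobounded ℂ)) {L : ℂ}
    (h : Tendsto (fun z => (∑ j ∈ J, m j / (T z - a j) ^ 2 + ∑ j ∈ J, β j / (T z - a j)) * T z ^ 4)
      k (𝓝 L)) :
    ∑ j ∈ J, β j = 0 ∧ ∑ j ∈ J, (a j * β j + m j) = 0 ∧
      ∑ j ∈ J, (a j ^ 2 * β j + 2 * a j * m j) = 0 := by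
  have hu := fun j => tendsto_inv_sub hT (a j)
  have hne := eventually_forall_ne J a hT
  have hT0 : Tendsto (fun z => (T z)⁻¹) k (𝓝 0) := tendsto_inv₀_cobounded.comp hT
  have hTne : ∀ᶠ z in k, T z ≠ 0 := hT.eventually (eventually_ne_cobounded 0)
  have h2 : Tendsto (fun z => (∑ j ∈ J, m j / (T z - a j) ^ 2 + ∑ j ∈ J, β j / (T z - a j)) *
      T z ^ 2) k (𝓝 0) := by
    have := h.mul (hT0.pow 2)
    rw [zero_pow two_ne_zero, mul_zero] at this
    refine this.congr' ?_
    filter_upwards [hTne] with z hz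
    generalize (∑ j ∈ J, m j / (T z - a j) ^ 2 + ∑ j ∈ J, β j / (T z - a j)) = q
    field_simp
  obtain ⟨s1, s2⟩ := sum_eq_of_tendsto_mul_sq J a m β hT h2
  refine ⟨s1, s2, ?_⟩
  have e1 := h.mul hT0
  rw [mul_zero] at e1
  have e2 : Tendsto (fun z => ∑ j ∈ J, (m j * (2 * a j * (1 + a j * (T z - a j)⁻¹) +
      a j ^ 2 * ((T z - a j)⁻¹ * (1 + a j * (T z - a j)⁻¹))) +
      β j * a j ^ 2 * (1 + a j * (T z - a j)⁻¹))) k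
      (𝓝 (∑ j ∈ J, (m j * (2 * a j * (1 + a j * 0) + a j ^ 2 * (0 * (1 + a j * 0))) +
        β j * a j ^ 2 * (1 + a j * 0)))) :=
    tendsto_finsetSum J fun j _ =>
      have hw := ((hu j).const_mul (a j)).const_add 1
      (((hw.const_mul (2 * a j)).add (((hu j).mul hw).const_mul (a j ^ 2))).const_mul (m j)).add
        (hw.const_mul (β j * a j ^ 2))
  have e3 := tendsto_nhds_unique (e1.congr' ?_) e2
  · rw [e3]
    refine Finset.sum_congr rfl fun j _ => ?_
    ring
  · filter_upwards [hne, hTne] with z hz hz0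
    -- The growing terms of P T^3 vanish by the first two relations; subtracting them term by term
    -- leaves convergent summands.
    have e4 : ∑ j ∈ J, (β j * T z ^ 2 + (a j * β j + m j) * T z) = 0 := by
      rw [Finset.sum_add_distrib, ← Finset.sum_mul, ← Finset.sum_mul, s1, s2, zero_mul, zero_mul,
        add_zero]
    rw [← sub_zero ((_ : ℂ) * _), ← e4, ← Finset.sum_add_distrib, Finset.sum_mul, Finset.sum_mul,
      ← Finset.sum_sub_distrib]
    refine Finset.sum_congr rfl fun j hj => ?_
    have := hz j hj
    field_simp
    ring

end Asymptotics

/-! ### The automorphic derivative as a rational function of the Hauptmodul -/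

theorem IsHauptmodul.exists_automorphicDerivative_eq (hgenus : HasGenusZero Γ)
    (ht : IsHauptmodul Γ t) :
    ∃ R : RatFunc ℂ, ∀ τ : ℍ, ∀ᶠ σ : ℍ in 𝓝[≠] τ,
      automorphicDerivative (t ∘ ofComplex) σ = R.eval (RingHom.id ℂ) (t σ) := by
  obtain ⟨g, hg, hgD⟩ := ht.1.exists_automorphicDerivative (ht.isNonconstantAt hgenus)
  obtain ⟨R, hR⟩ := ht.2 g hg
  refine ⟨R, fun τ => ?_⟩
  filter_upwards [hgD τ, eventually_nhdsNE_of_codiscrete hR τ] with σ h1 h2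
  rw [← h1, h2]

theorem coe_toComplex {x : OnePoint ℂ} (hx : x ≠ ∞) : (toComplex x : OnePoint ℂ) = x := by
  induction x using OnePoint.rec with
  | infty => exact absurd rfl hx
  | coe c => rfl

theorem mem_finiteIndices {r : ℕ} {a : Fin r → OnePoint ℂ} {j : Fin r} :
    j ∈ finiteIndices a ↔ a j ≠ ∞ := by
  simp [finiteIndices]

/-- The local data of a Hauptmodul at a point of order `N`. -/
theorem IsHauptmodul.exists_isLocalForm (hgenus : HasGenusZero Γ) (ht : IsHauptmodul Γ t) (z : ℍ) :
    ∃ c n v, IsLocalForm (t ∘ ofComplex) z c n v ∧ n.natAbs = pointOrder Γ z ∧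
      (¬ IsPole t z → 0 < n ∧ t z = c) ∧ (IsPole t z → n < 0 ∧ c = 0) := by
  have hnc := ht.isNonconstantAt hgenus
  obtain ⟨c, n, v, h1, h2, h3⟩ := ht.1.1.exists_isLocalForm (hnc z)
  refine ⟨c, n, v, h1, (pointOrder_eq_natAbs ht.1 hnc
    (fun τ σ h => ht.exists_smul_eq hgenus h) h1).symm, fun hp => ?_, fun hp => ?_⟩
  · have hn := (lt_or_gt_of_ne h1.ne_zero).resolve_left fun h => hp (h3 h)
    exact ⟨hn, (h2 hn).2⟩
  · have hn := (lt_or_gt_of_ne h1.ne_zero).resolve_right fun h => (h2 h).1 hp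
    exact ⟨hn, h1.const_eq_zero hn⟩

theorem natCast_natAbs_sq (n : ℤ) : ((n.natAbs : ℕ) : ℂ) ^ 2 = (n : ℂ) ^ 2 := by
  rw [Nat.cast_natAbs, ← Int.cast_pow, sq_abs, Int.cast_pow]

theorem IsHauptmodul.tendsto_automorphicDerivative_mul_sq (hgenus : HasGenusZero Γ)
    (ht : IsHauptmodul Γ t) {z : ℍ} (hp : ¬ IsPole t z) :
    Tendsto (fun σ : ℍ => automorphicDerivative (t ∘ ofComplex) σ * (t σ - t z) ^ 2) (𝓝[≠] z)
      (𝓝 (1 / 4 * (1 - 1 / (pointOrder Γ z : ℂ) ^ 2))) := by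
  obtain ⟨c, n, v, h, hn, h1, -⟩ := ht.exists_isLocalForm hgenus z
  have := tendsto_nhdsNE_coe.1 h.tendsto_automorphicDerivative_mul_sq
  rw [← hn, natCast_natAbs_sq, (h1 hp).2]
  simpa using this

/-- At a pole the local form has c = 0. The limit serves twice: it makes Φ vanish at infinity, and
it is the right-hand side of the relation when a_s = ∞. -/
theorem IsHauptmodul.tendsto_automorphicDerivative_mul_sq_of_isPole (hgenus : HasGenusZero Γ)
    (ht : IsHauptmodul Γ t) {z : ℍ} (hp : IsPole t z) :
    Tendsto (fun σ : ℍ => automorphicDerivative (t ∘ ofComplex) σ * t σ ^ 2) (𝓝[≠] z)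
      (𝓝 (1 / 4 * (1 - 1 / (pointOrder Γ z : ℂ) ^ 2))) := by
  obtain ⟨c, n, v, h, hn, -, h1⟩ := ht.exists_isLocalForm hgenus z
  have := tendsto_nhdsNE_coe.1 h.tendsto_automorphicDerivative_mul_sq
  rw [(h1 hp).2] at this
  rw [← hn, natCast_natAbs_sq]
  simpa using this

/-- At an ordinary point a Hauptmodul is a local coordinate. -/
theorem IsHauptmodul.deriv_ne_zero (hgenus : HasGenusZero Γ) (ht : IsHauptmodul Γ t) {z : ℍ}
    (hp : ¬ IsPole t z) (hz : ¬ IsEllipticPoint Γ z) : deriv (t ∘ ofComplex) z ≠ 0 := by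
  obtain ⟨c, n, v, h, hn, h1, -⟩ := ht.exists_isLocalForm hgenus z
  rw [pointOrder_eq_one_of_not_isEllipticPoint hz] at hn
  obtain ⟨hn0, hc⟩ := h1 hp
  obtain rfl : n = 1 := by lia
  have heq : t ∘ ofComplex =ᶠ[𝓝 (z : ℂ)] fun x => c + v x := by
    refine eventuallyEq_nhds_of_eventuallyEq_nhdsNE ?_ (by simp [h.map_zero, hc])
    filter_upwards [h.eventually_eq] with x hx
    rw [hx, zpow_one]
  rw [heq.deriv_eq, deriv_const_add]
  exact h.deriv_ne_zero

/-- A pole at a point of order one is simple, so n = -1. -/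
theorem IsHauptmodul.exists_tendsto_automorphicDerivative_mul_pow_four (hgenus : HasGenusZero Γ)
    (ht : IsHauptmodul Γ t) {z : ℍ} (hp : IsPole t z) (hz : ¬ IsEllipticPoint Γ z) :
    ∃ L, Tendsto (fun σ : ℍ => automorphicDerivative (t ∘ ofComplex) σ * t σ ^ 4) (𝓝[≠] z)
      (𝓝 L) := by
  obtain ⟨c, n, v, h, hn, -, h1⟩ := ht.exists_isLocalForm hgenus z
  rw [pointOrder_eq_one_of_not_isEllipticPoint hz] at hn
  obtain ⟨L, hL⟩ := h.tendsto_automorphicDerivative_mul_pow_four (by have := (h1 hp).1; lia)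
  exact ⟨L, by simpa using tendsto_nhdsNE_coe.1 hL⟩

/-- The partial fraction expansion of the automorphic derivative as a function of the
Hauptmodul. -/
theorem IsHauptmodul.exists_automorphicDerivative_eq_sum (hgenus : HasGenusZero Γ)
    (ht : IsHauptmodul Γ t) {r : ℕ} {τ : Fin r → ℍ} {e : Fin r → ℕ} (hτ : IsEllipticSystem Γ τ e)
    {a : Fin r → OnePoint ℂ} (ha : ∀ j, a j = sphereValue t (τ j)) :
    ∃ b : Fin r → ℂ, ∀ z : ℍ, ¬ IsPole t z → ¬ IsEllipticPoint Γ z →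
      automorphicDerivative (t ∘ ofComplex) z =
        ∑ j ∈ finiteIndices a, 1 / 4 * (1 - 1 / (e j : ℂ) ^ 2) / (t z - toComplex (a j)) ^ 2 +
          ∑ j ∈ finiteIndices a, b j / (t z - toComplex (a j)) := by
  have hnc := ht.isNonconstantAt hgenus
  have hsurj := ht.1.surjective_sphereValue hgenus hnc
  obtain ⟨R, hR⟩ := ht.exists_automorphicDerivative_eq hgenus
  set Φ : ℂ → ℂ := fun x => R.eval (RingHom.id ℂ) x
  have hmer : MeromorphicOn Φ Set.univ := fun x _ =>
    RatFunc.meromorphicAt_eval R (MeromorphicAt.id x)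
  have hval : ∀ z, IsEllipticPoint Γ z → ∃ j, a j = sphereValue t z := fun z hz => by
    obtain ⟨j, γ, hγ, rfl⟩ := hτ.complete z hz
    exact ⟨j, by rw [ha, ht.1.sphereValue_smul hγ]⟩
  have hfin : ∀ z, ¬ IsPole t z → ¬ IsEllipticPoint Γ z → ∀ j ∈ finiteIndices a,
      toComplex (a j) ≠ t z := fun z hp hz j hj h => by
    have h1 := coe_toComplex (mem_finiteIndices.1 hj)
    rw [h, ← sphereValue_of_not_isPole hp, ha] at h1
    obtain ⟨γ, hγ, rfl⟩ := ht.exists_smul_eq hgenus h1.symm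
    exact hz ((hτ.elliptic j).smul hγ)
  have hlim : ∀ z, ¬ IsPole t z → Tendsto t (𝓝[≠] z) (𝓝[≠] (t z)) := fun z hp => by
    have := ht.1.1.tendsto_punctured (hnc z)
    rwa [sphereValue_of_not_isPole hp, punctured_coe] at this
  have hpf := exists_partialFractions hmer (finiteIndices a) (a := fun j => toComplex (a j))
    (m := fun j => 1 / 4 * (1 - 1 / (e j : ℂ) ^ 2)) ?_ ?_ ?_ ?_
  · obtain ⟨b, hb⟩ := hpf
    refine ⟨b, fun z hp hz => ?_⟩
    have hta := ht.1.1.analyticAt hp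
    have hD := tendsto_nhdsNE_coe.1 ((analyticAt_automorphicDerivative hta
      (ht.deriv_ne_zero hgenus hp hz)).continuousAt.tendsto.mono_left nhdsWithin_le_nhds)
    have hQ : ContinuousAt (fun y => ∑ j ∈ finiteIndices a, 1 / 4 * (1 - 1 / (e j : ℂ) ^ 2) /
        (y - toComplex (a j)) ^ 2 + ∑ j ∈ finiteIndices a, b j / (y - toComplex (a j))) (t z) := by
      refine ContinuousAt.add (tendsto_finsetSum _ fun j hj => ?_)
        (tendsto_finsetSum _ fun j hj => ?_) <;>
      have hne := sub_ne_zero.2 (hfin z hp hz j hj).symm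
      · exact ContinuousAt.div (by fun_prop) (by fun_prop) (pow_ne_zero 2 hne)
      · exact ContinuousAt.div (by fun_prop) (by fun_prop) hne
    -- The identity holds near z but perhaps not at z; both sides are continuous there, since t has
    -- nonzero derivative and t z is none of the finite a j.
    refine tendsto_nhds_unique hD ((hQ.tendsto.comp
      (tendsto_nhds_of_tendsto_nhdsWithin (hlim z hp))).congr' ?_)
    filter_upwards [hR z, (hlim z hp).eventually (hb (t z))] with σ h1 h2
    rw [h1, Function.comp_apply, ← h2]
  · intro i hi j hj hij
    have h1 := coe_toComplex (mem_finiteIndices.1 hi)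
    have h2 := coe_toComplex (mem_finiteIndices.1 hj)
    simp only at hij
    rw [hij, h2, ha, ha] at h1
    exact (hτ.inequivalent j i (ht.exists_smul_eq hgenus h1)).symm
  · intro x hx
    obtain ⟨z, hz⟩ := hsurj x
    have hp : ¬ IsPole t z := fun hp => by
      rw [sphereValue_of_isPole hp] at hz
      exact OnePoint.infty_ne_coe x hz
    rw [sphereValue_of_not_isPole hp] at hz
    obtain rfl : t z = x := OnePoint.coe_injective hz
    have hell : ¬ IsEllipticPoint Γ z := fun h => by
      obtain ⟨j, hj⟩ := hval z h
      rw [sphereValue_of_not_isPole hp] at hj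
      exact hx j (mem_finiteIndices.2 (by rw [hj]; exact OnePoint.coe_ne_infty _)) (by rw [hj]; rfl)
    have hD := (analyticAt_automorphicDerivative (ht.1.1.analyticAt hp)
      (ht.deriv_ne_zero hgenus hp hell)).continuousAt.tendsto.mono_left
        (nhdsWithin_le_nhds (s := {(z : ℂ)}ᶜ))
    -- x is the value of t at an ordinary point z, where D is analytic; so Φ has a finite limit at
    -- x.
    refine ⟨_, tendsto_of_comp (MeromorphicAt.exists_tendsto_onePoint (hmer _ trivial))
      (hlim z hp) ((tendsto_nhdsNE_coe.1 hD).congr' (hR z))⟩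
  · intro j hj
    have hp : ¬ IsPole t (τ j) := fun hp =>
      mem_finiteIndices.1 hj (by rw [ha, sphereValue_of_isPole hp])
    have haj : toComplex (a j) = t (τ j) := by rw [ha, sphereValue_of_not_isPole hp]; rfl
    simp only [haj, ← hτ.order_eq]
    have hmer' : MeromorphicAt (fun y => Φ y * (y - t (τ j)) ^ 2) (t (τ j)) := by
      have := hmer (t (τ j)) trivial
      fun_prop
    refine tendsto_of_comp (MeromorphicAt.exists_tendsto_onePoint hmer') (hlim _ hp)
      ((ht.tendsto_automorphicDerivative_mul_sq hgenus hp).congr' ?_)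
    filter_upwards [hR (τ j)] with σ hσ
    rw [hσ]
  · obtain ⟨z, hz⟩ := hsurj ∞
    have hp := sphereValue_eq_infty_iff.1 hz
    have hT := ht.1.1.tendsto_punctured (hnc z)
    rw [hz, punctured_infty] at hT
    refine tendsto_of_comp (exists_tendsto_cobounded_of_meromorphicAt
      (RatFunc.meromorphicAt_eval R (MeromorphicAt.id 0).inv)) hT ?_
    -- D t^2 has a finite limit and 1/t tends to 0, so D itself tends to 0.
    have h1 := (ht.tendsto_automorphicDerivative_mul_sq_of_isPole hgenus hp).mul
      ((tendsto_inv₀_cobounded.comp hT).pow 2)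
    rw [zero_pow two_ne_zero, mul_zero] at h1
    refine h1.congr' ?_
    filter_upwards [hR z, hT.eventually (eventually_ne_cobounded 0)] with σ hσ h0
    rw [hσ, Function.comp_apply]
    field_simp
    rfl

end ShimuraCurve

/-! ### The theorem

The bijection of `Γ \ ℍ` with the sphere provided by the genus zero hypothesis already yields what
is classically deduced from arithmeticity: the orbits of `Γ` are discrete, and the quotient is
compact. -/

theorem proposition6
    {K : Type*} [Field K] [NumberField K] [NumberField.IsTotallyReal K]
    {B : Type*} [Ring B] [Algebra ℚ B] [Algebra K B] [Algebra.IsCentral K B] [IsSimpleRing B]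
    (hdim : Module.finrank K B = 4)
    (hsplit : Nonempty (ℝ ⊗[ℚ] B ≃ₐ[ℝ]
      Matrix (Fin 2) (Fin 2) ℝ × (Fin (Module.finrank ℚ K - 1) → Quaternion ℝ)))
    (hB : IsEmpty (B ≃+* Matrix (Fin 2) (Fin 2) ℚ))
    (ι : B →+* Matrix (Fin 2) (Fin 2) ℝ)
    (O : Subalgebra (𝓞 K) B) (hO : ShimuraCurve.IsOrder O)
    (Γ : Subgroup SL(2, ℝ)) (hΓ : Γ.Commensurable (ShimuraCurve.normOneGroup ι O))
    (hgenus : ShimuraCurve.HasGenusZero Γ)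
    {r : ℕ} (τ : Fin r → ℍ) (e : Fin r → ℕ) (hτ : ShimuraCurve.IsEllipticSystem Γ τ e)
    (t : ℍ → ℂ) (ht : ShimuraCurve.IsHauptmodul Γ t)
    (a : Fin r → OnePoint ℂ) (ha : ∀ j, a j = ShimuraCurve.sphereValue t (τ j)) :
    ∃ b : Fin r → ℂ,
      (∀ z : ℍ, ¬ ShimuraCurve.IsPole t z → ¬ ShimuraCurve.IsEllipticPoint Γ z →
        deriv (t ∘ UpperHalfPlane.ofComplex) z ≠ 0 ∧
        ShimuraCurve.automorphicDerivative (t ∘ UpperHalfPlane.ofComplex) z =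
          1 / 4 * ∑ j ∈ ShimuraCurve.finiteIndices a,
              (1 - 1 / (e j : ℂ) ^ 2) / (t z - ShimuraCurve.toComplex (a j)) ^ 2 +
            ∑ j ∈ ShimuraCurve.finiteIndices a, b j / (t z - ShimuraCurve.toComplex (a j))) ∧
      ((∀ j, a j ≠ ∞) →
        ∑ j, b j = 0 ∧
        ∑ j, (ShimuraCurve.toComplex (a j) * b j + 1 / 4 * (1 - 1 / (e j : ℂ) ^ 2)) = 0 ∧
        ∑ j, (ShimuraCurve.toComplex (a j) ^ 2 * b j +
          1 / 2 * ShimuraCurve.toComplex (a j) * (1 - 1 / (e j : ℂ) ^ 2)) = 0) ∧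
      (∀ s, a s = ∞ →
        ∑ j ∈ Finset.univ.erase s, b j = 0 ∧
        ∑ j ∈ Finset.univ.erase s,
          (ShimuraCurve.toComplex (a j) * b j + 1 / 4 * (1 - 1 / (e j : ℂ) ^ 2)) =
            1 / 4 * (1 - 1 / (e s : ℂ) ^ 2)) := by
  classical
  have hnc := ht.isNonconstantAt hgenus
  obtain ⟨b, hb⟩ := ht.exists_automorphicDerivative_eq_sum hgenus hτ ha
  obtain ⟨w, hw⟩ := ht.1.surjective_sphereValue hgenus hnc ∞
  have hinf : ∀ w, ShimuraCurve.sphereValue t w = ∞ →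
      Filter.Tendsto t (nhdsWithin w {w}ᶜ) (Bornology.cobounded ℂ) ∧
      ∀ᶠ σ : ℍ in nhdsWithin w {w}ᶜ,
        ShimuraCurve.automorphicDerivative (t ∘ UpperHalfPlane.ofComplex) σ =
        ∑ j ∈ ShimuraCurve.finiteIndices a, 1 / 4 * (1 - 1 / (e j : ℂ) ^ 2) /
            (t σ - ShimuraCurve.toComplex (a j)) ^ 2 +
          ∑ j ∈ ShimuraCurve.finiteIndices a, b j / (t σ - ShimuraCurve.toComplex (a j)) := by
    intro w hw
    have hT := ht.1.1.tendsto_punctured (hnc w)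
    rw [hw, ShimuraCurve.punctured_infty] at hT
    refine ⟨hT, ?_⟩
    -- Near w, t is large and so differs from every `toComplex (a j)`, including the default 0 for
    -- infinite a j; hence no nearby point other than w is elliptic.
    filter_upwards [ht.1.1.eventually_deriv_ne_zero (hnc w), ShimuraCurve.eventually_forall_ne
      Finset.univ (fun j => ShimuraCurve.toComplex (a j)) hT] with σ h1 h2
    refine hb σ h1.1 fun hσ => ?_
    obtain ⟨j, γ, hγ, rfl⟩ := hτ.complete σ hσ
    refine h2 j (Finset.mem_univ j) ?_
    rw [ha, ← ht.1.sphereValue_smul hγ, ShimuraCurve.sphereValue_of_not_isPole h1.1]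
    exact sub_self _
  refine ⟨b, fun z hp hz => ⟨ht.deriv_ne_zero hgenus hp hz, ?_⟩, fun hfin => ?_, fun s hs => ?_⟩
  · rw [hb z hp hz, Finset.mul_sum]
    simp only [mul_div_assoc]
  · have hJ : ShimuraCurve.finiteIndices a = Finset.univ := by
      ext j
      simp [ShimuraCurve.mem_finiteIndices, hfin j]
    obtain ⟨hT, hD⟩ := hinf w hw
    -- No elliptic point lies over infinity, so the pole w is ordinary and the fourth-power bound
    -- applies.
    have hell : ¬ ShimuraCurve.IsEllipticPoint Γ w := fun h => by
      obtain ⟨j, γ, hγ, rfl⟩ := hτ.complete w h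
      exact hfin j (by rw [ha, ← ht.1.sphereValue_smul hγ, hw])
    obtain ⟨L, hL⟩ := ht.exists_tendsto_automorphicDerivative_mul_pow_four hgenus
      (ShimuraCurve.sphereValue_eq_infty_iff.1 hw) hell
    obtain ⟨s1, s2, s3⟩ := ShimuraCurve.sum_eq_zero_of_tendsto_mul_pow_four _ _ _ _ hT
      (hL.congr' (hD.mono fun σ hσ => by rw [hσ]))
    rw [hJ] at s1 s2 s3
    refine ⟨s1, s2, Eq.trans (Finset.sum_congr rfl fun j _ => ?_) s3⟩
    ring
  · have hJ : ShimuraCurve.finiteIndices a = Finset.univ.erase s := by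
      ext j
      simp only [ShimuraCurve.mem_finiteIndices, Finset.mem_erase, Finset.mem_univ, and_true]
      refine ⟨fun h hj => h (hj ▸ hs), fun h hj => h ?_⟩
      -- Two elliptic representatives over infinity would be equivalent, so s is the only index with
      -- infinite value.
      exact hτ.inequivalent j s (ht.exists_smul_eq hgenus (by rw [← ha, ← ha, hj, hs]))
    have hs' := hs
    rw [ha] at hs'
    obtain ⟨hT, hD⟩ := hinf (τ s) hs'
    have h2 := ht.tendsto_automorphicDerivative_mul_sq_of_isPole hgenus
      (ShimuraCurve.sphereValue_eq_infty_iff.1 hs')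
    rw [hτ.order_eq] at h2
    have := ShimuraCurve.sum_eq_of_tendsto_mul_sq _ _ _ _ hT
      (h2.congr' (hD.mono fun σ hσ => by rw [hσ]))
    rwa [hJ] at this
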